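/- Let $p\ge 3$ be a prime, let $\mathcal K$ be a complete non-Archimedean field of characteristic $p$, and let $\lambda\in\mathcal K$ satisfy $|1-\lambda|<1$ and not be a root of unity. Let $$f(z)=z\Big(\lambda+\sum_{i\ge 1}a_iz^i\Big)\in\mathcal K[[z]]$$ be locally analytic at $0$ (i.e. have positive radius of convergence), with $a_i\neq 0$ for at least one $i\ge 1$. Put $a_0=\lambda$, $\mu=\lambda-1$, $\mathrm{val}_\mu(x)=\ln|x|/\ln|\mu|$ for $x\neq0$ and $\mathrm{val}_\mu(0)=+\infty$, $u=\gcd\{i\ge 1: a_i\ne 0\}$ and $\tau=\mathrm{val}_p(u)$, the exponent of $p$ in $u$. For integers $0\le r<s$ let $I(r,s)$ be the set of $\alpha=(\alpha_0,\dots,\alpha_{s-r})\in\mathbb N^{s-r+1}$ with $\sum_i\alpha_i=r+1$, $\sum_i i\alpha_i=s-r$, and $\alpha_i=0$ whenever $u\nmid i$, and put $$\Phi(r,s)=\frac{1}{\lambda(1-\lambda^s)}\sum_{\alpha\in I(r,s)}\binom{r+1}{\alpha_0,\dots,\alpha_{s-r}}\prod_{i=0}^{s-r}a_i^{\alpha_i}\in\mathcal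 K .$$ For $k\ge 0$ and $0\le r<s$ put $$\phi_k(r,s)=\sum_{\beta}\ \prod_{j=0}^{t-1}\Phi(u\beta_j,u\beta_{j+1}),\qquad \psi_k(r,s)=\phi_k(r,s)\,\frac{1-\lambda^{us}}{(1-\lambda^{p^{k+\tau}})\lambda^{us-1}},$$ where $\beta$ runs over all integer sequences $r=\beta_0<\beta_1<\dots<\beta_t=s$ with $t\ge 1$ such that $p^k\nmid\beta_j$ for $1\le j\le t-1$. For $p^k$-divisible integers $0\le r<s$ put $M_k(r,s)=\mathrm{val}_\mu(\psi_k(r,s))/(s-r)$, and let $M_k$ be the infimum of $M_k(r,s)$ over all such $r,s$. For $k\ge 1$, call $f$ $k$-dominant if $$\min_{1\le d\le p-1}M_k(0,dp^k)\ \le\ \min_{0\le \ell\le k-1}M_\ell\;-\;p^{\tau-1}.$$ If $f$ is $k$-dominant for some integer $k\ge1$, then $f$ is not locally linearizable at $0$; that is, there is no locally analytic (at $0$) power series $h(z)=z\sum_{n\ge 0}b_nz^n\in\mathcal K[[z]]$, invertible under composition, with $h\circ f\circ h^{-1}(z)=\lambda z$. -/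

import Mathlib

namespace NonLin

noncomputable section

open PowerSeries

/-- A power series is locally analytic at `0` if it has positive radius of convergence:
`‖cₙ‖ ρⁿ → 0` for some `ρ > 0`. -/
def LocallyAnalytic {K : Type*} [NormedField K] (f : PowerSeries K) : Prop :=
  ∃ ρ : ℝ, 0 < ρ ∧ PowerSeries.IsRestricted ρ f

/-- `f` is locally linearizable at `0`: there is a locally analytic `h` with `h(0) = 0` which has a
compositional inverse `g = h⁻¹`, and `h ∘ f ∘ h⁻¹ (z) = λ z`, where `λ = f'(0)`.
(`PowerSeries.subst a b` is the composition `b ∘ a`.) -/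
def Linearizable {K : Type*} [NormedField K] (f : PowerSeries K) : Prop :=
  ∃ h g : PowerSeries K, LocallyAnalytic h ∧
    constantCoeff h = 0 ∧ constantCoeff g = 0 ∧
    subst g h = (X : PowerSeries K) ∧ subst h g = (X : PowerSeries K) ∧
    subst (subst g f : PowerSeries K) h = C (coeff 1 f) * (X : PowerSeries K)

/-- The coefficients `a₀ = λ, a₁, a₂, …` of `f(z) = z (λ + a₁ z + a₂ z² + ⋯)`. -/
def a {K : Type*} [NormedField K] (f : PowerSeries K) (i : ℕ) : K := coeff (i + 1) f

/-- The `μ`-adic valuation `log |x| / log |μ|`, where `μ = λ - 1`; its value at `0` is `∞`. -/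
def valMu {K : Type*} [NormedField K] (f : PowerSeries K) (x : K) : EReal :=
  open scoped Classical in
  if x = 0 then ⊤ else ((Real.log ‖x‖ / Real.log ‖a f 0 - 1‖ : ℝ) : EReal)

/-- The greatest common divisor of the `i ≥ 1` with `aᵢ ≠ 0` (it is `0` if there are none). -/
def u {K : Type*} [NormedField K] (f : PowerSeries K) : ℕ :=
  sSup {d : ℕ | ∀ i : ℕ, 1 ≤ i → a f i ≠ 0 → d ∣ i}

/-- The `p`-adic valuation of `u`. -/
def tau {K : Type*} [NormedField K] (p : ℕ) (f : PowerSeries K) : ℕ := padicValNat p (u f)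

/-- The multi-indices `α ∈ ℕ^(s-r+1)` with `∑ αᵢ = r + 1`, `∑ i αᵢ = s - r`, and `αᵢ = 0` whenever
`u ∤ i`. -/
def I {K : Type*} [NormedField K] (f : PowerSeries K) (r s : ℕ) : Finset (Fin (s - r + 1) → ℕ) :=
  open scoped Classical in
  ((Finset.univ : Finset (Fin (s - r + 1))).piAntidiag (r + 1)).filter fun α =>
    (∑ i : Fin (s - r + 1), (i : ℕ) * α i = s - r) ∧
      ∀ i : Fin (s - r + 1), ¬ u f ∣ (i : ℕ) → α i = 0

/-- `Φ(r, s) = (λ (1 - λˢ))⁻¹ ∑_{α ∈ I(r, s)} binom(r + 1; α) a^α`. -/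
def Phi {K : Type*} [NormedField K] (f : PowerSeries K) (r s : ℕ) : K :=
  1 / (a f 0 * (1 - a f 0 ^ s)) *
    ∑ α ∈ I f r s, (Nat.multinomial Finset.univ α : K) * ∏ i : Fin (s - r + 1), a f i ^ α i

/-- The sequences `r = β₀ < β₁ < ⋯ < βₜ = s` none of whose middle terms `β₁, …, βₜ₋₁` is
divisible by `p ^ k`. -/
def S (p k r s t : ℕ) : Finset (Fin (t + 1) → ℕ) :=
  open scoped Classical in
  (Fintype.piFinset fun _ : Fin (t + 1) => Finset.Icc r s).filter fun β =>
    StrictMono β ∧ β 0 = r ∧ β (Fin.last t) = s ∧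
      ∀ j : Fin (t + 1), j ≠ 0 → j ≠ Fin.last t → ¬ p ^ k ∣ β j

/-- `φ_k(r, s)`: the sum, over all increasing sequences `β` from `r` to `s` without middle terms
divisible by `p ^ k`, of the products `∏ⱼ Φ(u βⱼ, u βⱼ₊₁)`. -/
def phi {K : Type*} [NormedField K] (p : ℕ) (f : PowerSeries K) (k r s : ℕ) : K :=
  ∑ t ∈ Finset.Icc 1 (s - r), ∑ β ∈ S p k r s t,
    ∏ j : Fin t, Phi f (u f * β j.castSucc) (u f * β j.succ)

/-- `ψ_k(r, s) = φ_k(r, s) (1 - λ^(us)) / ((1 - λ^(p^(k+τ))) λ^(us-1))`. -/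
def psi {K : Type*} [NormedField K] (p : ℕ) (f : PowerSeries K) (k r s : ℕ) : K :=
  phi p f k r s *
    ((1 - a f 0 ^ (u f * s)) / ((1 - a f 0 ^ p ^ (k + tau p f)) * a f 0 ^ (u f * s - 1)))

/-- The slope `M_k(r, s) = val_μ(ψ_k(r, s)) / (s - r)`. -/
def slope {K : Type*} [NormedField K] (p : ℕ) (f : PowerSeries K) (k r s : ℕ) : EReal :=
  valMu f (psi p f k r s) / (((s : ℝ) - (r : ℝ) : ℝ) : EReal)

/-- `M_k`, the infimum of the slopes `M_k(r, s)` over the `p ^ k`-divisible integers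
`0 ≤ r < s`. -/
def M {K : Type*} [NormedField K] (p : ℕ) (f : PowerSeries K) (k : ℕ) : EReal :=
  sInf {m : EReal | ∃ r s : ℕ, p ^ k ∣ r ∧ p ^ k ∣ s ∧ r < s ∧ m = slope p f k r s}

/-- `f` is `k`-dominant:
`min_{1 ≤ d ≤ p-1} M_k(0, d p^k) ≤ min_{0 ≤ ℓ ≤ k-1} M_ℓ - p^(τ-1)`. -/
def Dominant {K : Type*} [NormedField K] (p : ℕ) (f : PowerSeries K) (k : ℕ) : Prop :=
  (⨅ d ∈ Finset.Icc 1 (p - 1), slope p f k 0 (d * p ^ k)) ≤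
    (⨅ l ∈ Finset.range k, M p f l) - (((p : ℝ) ^ ((tau p f : ℤ) - 1) : ℝ) : EReal)

end

end NonLin

/-!
The coefficients of a linearization `h` satisfy a linear recursion with kernel `Φ`, so they are sums
over chains of products of values of `Φ`. Cutting the chains at their middle terms divisible by
`p ^ k` expresses them through `φ_k`, equivalently through the normalized `ψ_k`.

Under dominance at level `k + 1`, the values `ψ_{k+1}(0, d p^(k+1))`, `1 ≤ d < p`, are so large
compared with all `ψ_l`, `l ≤ k`, that they determine `ψ_{k+1}` up to smaller terms, which makes it
nearly invariant under translations. If dominance were lost at the next level, the generating series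
`Y` of the recursion would satisfy, up to smaller terms and in degrees below `p²`, a differential
equation `E Y = W Y`, where `E = z d/dz` and `W` has Weierstrass degree `1 ≤ e < p`. But then
`E^p Y = W_p Y` with `W_p` of Weierstrass degree `p e`, whereas `E^p = E` in characteristic `p`.

Hence dominance propagates to all higher levels, and the growth rate of the coefficients of `h`
increases by a fixed factor at each of them, which leaves no room for a positive radius of
convergence.
-/

namespace NonLin

section Chains

theorem zero_add_le_of_strictMono {t : ℕ} {β : Fin (t + 1) → ℕ} (hβ : StrictMono β)
    (i : Fin (t + 1)) : β 0 + i ≤ β i := by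
  induction i using Fin.induction with
  | zero => simp
  | succ i ih =>
    have := hβ (Fin.castSucc_lt_succ (i := i))
    simp only [Fin.val_castSucc, Fin.val_succ] at *
    lia

theorem mem_S {p k r s t : ℕ} {β : Fin (t + 1) → ℕ} :
    β ∈ S p k r s t ↔ StrictMono β ∧ β 0 = r ∧ β (Fin.last t) = s ∧
      ∀ j : Fin (t + 1), j ≠ 0 → j ≠ Fin.last t → ¬ p ^ k ∣ β j := by
  simp only [S, Finset.mem_filter, Fintype.mem_piFinset, Finset.mem_Icc, and_iff_right_iff_imp]
  rintro ⟨h, rfl, rfl, -⟩ j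
  exact ⟨h.monotone (Fin.zero_le j), h.monotone (Fin.le_last j)⟩

theorem S_eq_empty {p k r s t : ℕ} (h : s - r < t) : S p k r s t = ∅ := by
  refine Finset.eq_empty_of_forall_notMem fun β hβ => ?_
  obtain ⟨hm, h0, hl, -⟩ := mem_S.1 hβ
  have := zero_add_le_of_strictMono hm (Fin.last t)
  rw [h0, hl, Fin.val_last] at this
  lia

theorem S_one (p k : ℕ) {r s : ℕ} (h : r < s) : S p k r s 1 = {![r, s]} := by
  ext β
  rw [mem_S, Finset.mem_singleton, Fin.strictMono_iff_lt_succ]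
  refine ⟨fun ⟨_, h0, h1, _⟩ => ?_, ?_⟩
  · ext j
    fin_cases j
    exacts [h0, h1]
  · rintro rfl
    simp [Fin.forall_fin_two, h]

theorem snoc_mem_S {p k r s t : ℕ} (ht : 1 ≤ t) {γ : Fin (t + 1) → ℕ} :
    (Fin.snoc γ s : Fin (t + 2) → ℕ) ∈ S p k r s (t + 1) ↔
      γ ∈ S p k r (γ (Fin.last t)) t ∧ γ (Fin.last t) < s ∧ ¬ p ^ k ∣ γ (Fin.last t) := by
  have ht0 : t ≠ 0 := by lia
  have hzero : (Fin.snoc γ s : Fin (t + 2) → ℕ) 0 = γ 0 := by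
    rw [← Fin.castSucc_zero, Fin.snoc_castSucc]
  simp only [mem_S, Fin.strictMono_iff_lt_succ, Fin.forall_fin_succ' (n := t + 1),
    Fin.forall_fin_succ' (n := t), Fin.snoc_castSucc, Fin.snoc_last, Fin.succ_castSucc,
    Fin.succ_last, hzero, ne_eq, Fin.castSucc_eq_zero_iff, not_true, Fin.castSucc_ne_last,
    not_false_eq_true, forall_const, Fin.last_eq_zero_iff, ht0, Nat.add_eq_zero_iff, one_ne_zero,
    and_self, IsEmpty.forall_iff, and_true, true_and]
  tauto

variable {R : Type*}

/-- The sum over `S p k r s t` of the weights `∏ⱼ w (βⱼ) (βⱼ₊₁)`, so that `phi` is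
`∑ t ∈ Icc 1 (s - r), chainSum w p k r s t` for `w x y = Φ(u x, u y)`. -/
def chainSum [CommSemiring R] (w : ℕ → ℕ → R) (p k r s t : ℕ) : R :=
  ∑ β ∈ S p k r s t, ∏ j : Fin t, w (β j.castSucc) (β j.succ)

theorem chainSum_one [CommSemiring R] (w : ℕ → ℕ → R) (p k : ℕ) {r s : ℕ} (h : r < s) :
    chainSum w p k r s 1 = w r s := by
  simp [chainSum, S_one p k h]

theorem chainSum_succ [CommSemiring R] (w : ℕ → ℕ → R) (p k r s : ℕ) {t : ℕ} (ht : 1 ≤ t) :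
    chainSum w p k r s (t + 1) =
      ∑ x ∈ Finset.Ioo r s with ¬ p ^ k ∣ x, chainSum w p k r x t * w x s := by
  simp_rw [chainSum, Finset.sum_mul]
  rw [Finset.sum_sigma']
  have snoc_init {β : Fin (t + 2) → ℕ} (hβ : β ∈ S p k r s (t + 1)) :
      Fin.snoc (Fin.init β) s = β := by
    rw [← (mem_S.1 hβ).2.2.1, Fin.snoc_init_self]
  refine Finset.sum_bij' (fun β _ => ⟨β (Fin.last t).castSucc, Fin.init β⟩)
    (fun γ _ => Fin.snoc γ.2 s) (fun β hβ => ?_) (fun ⟨x, γ⟩ hγ => ?_)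
    (fun β hβ => snoc_init hβ) (fun ⟨x, γ⟩ hγ => ?_) fun β hβ => ?_
  · rw [← snoc_init hβ, snoc_mem_S ht] at hβ
    obtain ⟨hγ, hs, hdvd⟩ := hβ
    have hr := zero_add_le_of_strictMono (mem_S.1 hγ).1 (Fin.last t)
    rw [(mem_S.1 hγ).2.1, Fin.val_last, Fin.init] at hr
    simp only [Finset.mem_sigma, Finset.mem_filter, Finset.mem_Ioo]
    exact ⟨⟨⟨by lia, hs⟩, hdvd⟩, hγ⟩
  · simp only [Finset.mem_sigma, Finset.mem_filter, Finset.mem_Ioo] at hγ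
    obtain ⟨⟨⟨-, hs⟩, hdvd⟩, hγ⟩ := hγ
    obtain rfl : γ (Fin.last t) = x := (mem_S.1 hγ).2.2.1
    exact (snoc_mem_S ht).2 ⟨hγ, hs, hdvd⟩
  · simp only [Finset.mem_sigma] at hγ
    obtain rfl : γ (Fin.last t) = x := (mem_S.1 hγ.2).2.2.1
    simp
  · rw [Fin.prod_univ_castSucc, Fin.succ_last, (mem_S.1 hβ).2.2.1]
    rfl

theorem sum_chainSum_eq_sum_range [CommSemiring R] (w : ℕ → ℕ → R) (p k : ℕ) {r s n : ℕ}
    (h : s - r ≤ n) : ∑ t ∈ Finset.Icc 1 (s - r), chainSum w p k r s t =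
      ∑ t ∈ Finset.range n, chainSum w p k r s (t + 1) := by
  rw [Finset.range_eq_Ico, Finset.sum_Ico_add' (chainSum w p k r s)]
  refine Finset.sum_subset (fun t ht => ?_) fun t ht ht' => ?_ <;>
    simp only [Finset.mem_Icc, Finset.mem_Ico] at *
  · lia
  · rw [chainSum, S_eq_empty (by lia), Finset.sum_empty]

theorem sum_chainSum_eq [CommSemiring R] (w : ℕ → ℕ → R) (p k : ℕ) {r s : ℕ} (h : r < s) :
    ∑ t ∈ Finset.Icc 1 (s - r), chainSum w p k r s t =
      w r s + ∑ x ∈ Finset.Ioo r s with ¬ p ^ k ∣ x,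
        (∑ t ∈ Finset.Icc 1 (x - r), chainSum w p k r x t) * w x s := by
  obtain ⟨n, hn⟩ : ∃ n, s - r = n + 1 := ⟨s - r - 1, by lia⟩
  rw [sum_chainSum_eq_sum_range w p k hn.le, Finset.sum_range_succ', chainSum_one w p k h, add_comm,
    Finset.sum_congr rfl fun t _ => chainSum_succ w p k r s t.succ_pos, Finset.sum_comm]
  congr 1
  refine Finset.sum_congr rfl fun x hx => ?_
  simp only [Finset.mem_filter, Finset.mem_Ioo] at hx
  rw [sum_chainSum_eq_sum_range w p k (show x - r ≤ n by lia), Finset.sum_mul]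

theorem sum_Ioo_sum_Ioo_comm {M : Type*} [AddCommMonoid M] (P Q : ℕ → Prop) [DecidablePred P]
    [DecidablePred Q] (r s : ℕ) (F : ℕ → ℕ → M) :
    ∑ x ∈ Finset.Ioo r s with P x, ∑ y ∈ Finset.Ioo r x with Q y, F x y =
      ∑ y ∈ Finset.Ioo r s with Q y, ∑ x ∈ Finset.Ioo y s with P x, F x y :=
  Finset.sum_comm' fun x y => by grind

/-- Passing from the forbidden middle terms `P` to the fewer forbidden middle terms `P'`: cut a
chain at its last middle term in `P`. -/
theorem rec_refine [CommSemiring R] {w φ : ℕ → ℕ → R} {φ' : ℕ → R} {P P' : ℕ → Prop}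
    [DecidablePred P] [DecidablePred P'] (hPP : ∀ x, P' x → P x)
    (hφ : ∀ r s, r < s → φ r s = w r s + ∑ x ∈ Finset.Ioo r s with ¬ P x, φ r x * w x s) {r : ℕ}
    (hφ' : ∀ s, r < s → φ' s = w r s + ∑ x ∈ Finset.Ioo r s with ¬ P' x, φ' x * w x s)
    {s : ℕ} (h : r < s) :
    φ' s = φ r s + ∑ x ∈ Finset.Ioo r s with P x ∧ ¬ P' x, φ' x * φ x s := by
  induction s using Nat.strong_induction_on with
  | _ s ih =>
  have hsplit : ∑ x ∈ Finset.Ioo r s with ¬ P' x, φ' x * w x s =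
      ∑ x ∈ Finset.Ioo r s with P x ∧ ¬ P' x, φ' x * w x s +
        ∑ x ∈ Finset.Ioo r s with ¬ P x, φ' x * w x s := by
    rw [← Finset.sum_filter_add_sum_filter_not _ P, Finset.filter_filter, Finset.filter_filter,
      Finset.filter_congr fun x _ => and_comm,
      Finset.filter_congr fun x _ => and_iff_right_of_imp (mt (hPP x))]
  have hbefore : ∑ x ∈ Finset.Ioo r s with ¬ P x, φ' x * w x s =
      ∑ x ∈ Finset.Ioo r s with ¬ P x, φ r x * w x s +
        ∑ x ∈ Finset.Ioo r s with ¬ P x,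
          ∑ y ∈ Finset.Ioo r x with P y ∧ ¬ P' y, φ' y * φ y x * w x s := by
    rw [← Finset.sum_add_distrib]
    refine Finset.sum_congr rfl fun x hx => ?_
    simp only [Finset.mem_filter, Finset.mem_Ioo] at hx
    rw [ih x hx.1.2 hx.1.1, add_mul, Finset.sum_mul]
  have hafter : ∑ y ∈ Finset.Ioo r s with P y ∧ ¬ P' y, φ' y * φ y s =
      ∑ y ∈ Finset.Ioo r s with P y ∧ ¬ P' y, φ' y * w y s +
        ∑ y ∈ Finset.Ioo r s with P y ∧ ¬ P' y,
          ∑ x ∈ Finset.Ioo y s with ¬ P x, φ' y * φ y x * w x s := by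
    rw [← Finset.sum_add_distrib]
    refine Finset.sum_congr rfl fun y hy => ?_
    simp only [Finset.mem_filter, Finset.mem_Ioo] at hy
    simp_rw [hφ y s hy.1.2, mul_add, Finset.mul_sum, mul_assoc]
  rw [hφ' s h, hφ r s h, hsplit, hbefore, hafter, sum_Ioo_sum_Ioo_comm]
  abel

end Chains

section Phi

open PowerSeries

theorem coeff_mk_pow {R : Type*} [CommSemiring R] (c : ℕ → R) (N n : ℕ) :
    coeff N (mk c ^ n) = ∑ α ∈ (Finset.univ : Finset (Fin (N + 1))).piAntidiag n with
      ∑ i : Fin (N + 1), (i : ℕ) * α i = N,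
        (Nat.multinomial Finset.univ α : R) * ∏ i : Fin (N + 1), c i ^ α i := by
  have htrunc : (trunc (N + 1) (mk c) : R⟦X⟧) = ∑ i : Fin (N + 1), C (c i) * X ^ (i : ℕ) := by
    rw [Fin.sum_univ_eq_sum_range fun i => (C (c i) * X ^ i : R⟦X⟧)]
    ext j
    simp [coeff_trunc, coeff_X_pow]
  have hterm (α : Fin (N + 1) → ℕ) : ∏ i : Fin (N + 1), (C (c i) * X ^ (i : ℕ) : R⟦X⟧) ^ α i =
      C (∏ i : Fin (N + 1), c i ^ α i) * X ^ (∑ i : Fin (N + 1), (i : ℕ) * α i) := by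
    simp_rw [mul_pow, Finset.prod_mul_distrib, map_prod, map_pow, ← pow_mul,
      Finset.prod_pow_eq_pow_sum]
  rw [← coeff_coe_trunc_of_lt N.lt_succ_self, ← trunc_trunc_pow,
    coeff_coe_trunc_of_lt N.lt_succ_self, htrunc, Finset.sum_pow_eq_sum_piAntidiag, map_sum,
    Finset.sum_filter]
  refine Finset.sum_congr rfl fun α _ => ?_
  rw [hterm, ← map_natCast (C (R := R)), ← mul_assoc, ← map_mul, coeff_C_mul, coeff_X_pow,
    mul_ite, mul_one, mul_zero]
  simp only [eq_comm]

variable {K : Type*} [NormedField K] {f : K⟦X⟧}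

theorem phi_eq_Phi_add_sum (p : ℕ) (f : K⟦X⟧) (k : ℕ) {r s : ℕ} (h : r < s) :
    phi p f k r s = Phi f (u f * r) (u f * s) +
      ∑ x ∈ Finset.Ioo r s with ¬ p ^ k ∣ x, phi p f k r x * Phi f (u f * x) (u f * s) :=
  sum_chainSum_eq (fun x y => Phi f (u f * x) (u f * y)) p k h

theorem phi_succ (p : ℕ) (f : K⟦X⟧) (k : ℕ) {r s : ℕ} (h : r < s) :
    phi p f (k + 1) r s = phi p f k r s +
      ∑ x ∈ Finset.Ioo r s with p ^ k ∣ x ∧ ¬ p ^ (k + 1) ∣ x,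
        phi p f (k + 1) r x * phi p f k x s :=
  rec_refine (fun _ hx => (pow_dvd_pow p k.le_succ).trans hx)
    (fun _ _ => phi_eq_Phi_add_sum p f k) (fun _ => phi_eq_Phi_add_sum p f (k + 1)) h

theorem phi_zero (p : ℕ) (f : K⟦X⟧) {r s : ℕ} (h : r < s) :
    phi p f 0 r s = Phi f (u f * r) (u f * s) := by
  simp [phi_eq_Phi_add_sum p f 0 h]

theorem u_dvd (hf : ∃ i, 1 ≤ i ∧ a f i ≠ 0) {i : ℕ} (hi : 1 ≤ i) (hai : a f i ≠ 0) : u f ∣ i := by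
  obtain ⟨j, hj, haj⟩ := hf
  exact Nat.sSup_mem (s := {d : ℕ | ∀ i : ℕ, 1 ≤ i → a f i ≠ 0 → d ∣ i})
    ⟨1, fun i _ _ => one_dvd i⟩ ⟨j, fun d hd => Nat.le_of_dvd hj (hd j hj haj)⟩ i hi hai

theorem u_pos (hf : ∃ i, 1 ≤ i ∧ a f i ≠ 0) : 0 < u f := by
  obtain ⟨i, hi, hai⟩ := hf
  exact Nat.pos_of_dvd_of_pos (u_dvd ⟨i, hi, hai⟩ hi hai) hi

theorem Phi_eq (hf : ∃ i, 1 ≤ i ∧ a f i ≠ 0) (r s : ℕ) :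
    Phi f r s = 1 / (a f 0 * (1 - a f 0 ^ s)) * coeff (s - r) (mk (a f) ^ (r + 1)) := by
  classical
  rw [Phi, coeff_mk_pow, I, ← Finset.filter_filter, Finset.sum_filter_of_ne]
  intro α _ hα i hi
  by_contra hαi
  have hai : a f i ≠ 0 := by
    rw [← pow_ne_zero_iff hαi]
    exact Finset.prod_ne_zero_iff.1 (right_ne_zero_of_mul hα) i (Finset.mem_univ i)
  have hi0 : (i : ℕ) ≠ 0 := fun h0 => hi (h0 ▸ dvd_zero _)
  exact hi (u_dvd hf (Nat.one_le_iff_ne_zero.2 hi0) hai)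

end Phi

section Norms

open IsUltrametricDist

section AddGroup

variable {E : Type*} [SeminormedAddCommGroup E] [IsUltrametricDist E] {x y : E} {c : ℝ}

theorem norm_sub_le_max (x y : E) : ‖x - y‖ ≤ max ‖x‖ ‖y‖ := by
  rw [sub_eq_add_neg, ← norm_neg y]
  exact norm_add_le_max x (-y)

theorem norm_add_lt (hx : ‖x‖ < c) (hy : ‖y‖ < c) : ‖x + y‖ < c :=
  (norm_add_le_max x y).trans_lt (max_lt hx hy)

theorem norm_sub_lt (hx : ‖x‖ < c) (hy : ‖y‖ < c) : ‖x - y‖ < c :=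
  (norm_sub_le_max x y).trans_lt (max_lt hx hy)

theorem norm_sum_lt {ι : Type*} {s : Finset ι} {g : ι → E} (hc : 0 < c)
    (h : ∀ i ∈ s, ‖g i‖ < c) : ‖∑ i ∈ s, g i‖ < c := by
  rcases s.eq_empty_or_nonempty with rfl | hs
  · simpa
  · obtain ⟨i, hi, hle⟩ := exists_norm_finsetSum_le_of_nonempty hs g
    exact hle.trans_lt (h i hi)

theorem norm_eq_of_norm_sub_lt (h : ‖x - y‖ < ‖y‖) : ‖x‖ = ‖y‖ := by
  rw [← norm_neg y]
  refine norm_eq_of_add_norm_lt_max ?_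
  rw [← sub_eq_add_neg, norm_neg]
  exact lt_max_of_lt_right h

end AddGroup

variable {K : Type*} [NormedField K]

section Char

variable (p : ℕ) [Fact p.Prime] [CharP K p]

theorem natCast_pow_char_pow (N n : ℕ) : (n : K) ^ p ^ N = n := by
  rw [← iterateFrobenius_def, map_natCast]

theorem norm_natCast_eq_one {n : ℕ} (hn : ¬ p ∣ n) : ‖(n : K)‖ = 1 := by
  have hn0 : ‖(n : K)‖ ≠ 0 := by rwa [norm_ne_zero_iff, Ne, CharP.cast_eq_zero_iff K p]
  have hpow : ‖(n : K)‖ ^ p = ‖(n : K)‖ := by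
    rw [← norm_pow, ← pow_one p, natCast_pow_char_pow]
  have hp : p - 1 ≠ 0 := Nat.sub_ne_zero_of_lt (Fact.out : p.Prime).one_lt
  rw [← pow_eq_one_iff_of_nonneg (norm_nonneg _) hp, ← mul_left_inj' hn0, one_mul,
    pow_sub_one_mul (Fact.out : p.Prime).ne_zero, hpow]

theorem one_sub_pow_char_pow_mul (x : K) (N n : ℕ) :
    1 - x ^ (p ^ N * n) = (1 - x ^ n) ^ p ^ N := by
  rw [sub_pow_char_pow, one_pow, ← pow_mul, mul_comm]

end Char

variable [IsUltrametricDist K] {x : K}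

theorem norm_eq_one_of_norm_one_sub_lt (h : ‖1 - x‖ < 1) : ‖x‖ = 1 := by
  rw [norm_eq_of_norm_sub_lt (y := 1) (by rwa [norm_sub_rev, norm_one]), norm_one]

theorem norm_one_sub_pow_le (hx : ‖x‖ ≤ 1) (n : ℕ) : ‖1 - x ^ n‖ ≤ ‖1 - x‖ := by
  rw [← mul_neg_geom_sum, norm_mul]
  refine mul_le_of_le_one_right (norm_nonneg _) ?_
  refine norm_sum_le_of_forall_le_of_nonneg zero_le_one fun i _ => ?_
  rw [norm_pow]
  exact pow_le_one₀ (norm_nonneg _) hx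

theorem norm_one_sub_pow_lt_one (h : ‖1 - x‖ < 1) (n : ℕ) : ‖1 - x ^ n‖ < 1 :=
  (norm_one_sub_pow_le (norm_eq_one_of_norm_one_sub_lt h).le n).trans_lt h

theorem norm_geom_sum_sub_natCast_lt_one (h : ‖1 - x‖ < 1) (n : ℕ) :
    ‖∑ j ∈ Finset.range n, x ^ j - (n : K)‖ < 1 := by
  have hsum : ∑ j ∈ Finset.range n, x ^ j - (n : K) = ∑ j ∈ Finset.range n, (x ^ j - 1) := by simp
  rw [hsum]
  refine norm_sum_lt one_pos fun j _ => ?_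
  rw [norm_sub_rev]
  exact norm_one_sub_pow_lt_one h j

section Char

variable (p : ℕ) [Fact p.Prime] [CharP K p]

theorem norm_geom_sum_eq_one (h : ‖1 - x‖ < 1) {n : ℕ} (hn : ¬ p ∣ n) :
    ‖∑ j ∈ Finset.range n, x ^ j‖ = 1 := by
  have hn1 := norm_natCast_eq_one (K := K) p hn
  rw [← hn1]
  exact norm_eq_of_norm_sub_lt ((norm_geom_sum_sub_natCast_lt_one h n).trans_eq hn1.symm)

theorem norm_one_sub_pow_char_pow_mul_le (hx : ‖x‖ ≤ 1) (N n : ℕ) :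
    ‖1 - x ^ (p ^ N * n)‖ ≤ ‖1 - x‖ ^ p ^ N := by
  rw [one_sub_pow_char_pow_mul, norm_pow]
  exact pow_le_pow_left₀ (norm_nonneg _) (norm_one_sub_pow_le hx n) _

theorem norm_one_sub_pow_char_pow_mul (h : ‖1 - x‖ < 1) (N : ℕ) {n : ℕ} (hn : ¬ p ∣ n) :
    ‖1 - x ^ (p ^ N * n)‖ = ‖1 - x‖ ^ p ^ N := by
  rw [one_sub_pow_char_pow_mul, ← mul_neg_geom_sum, norm_pow, norm_mul,
    norm_geom_sum_eq_one p h hn, mul_one]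

end Char

theorem one_sub_pow_ne_zero (p : ℕ) [Fact p.Prime] [CharP K p] (hx : x ≠ 1) (h : ‖1 - x‖ < 1)
    {n : ℕ} (hn : n ≠ 0) : 1 - x ^ n ≠ 0 := by
  obtain ⟨N, m, hm, rfl⟩ := Nat.exists_eq_pow_mul_and_not_dvd hn p (Fact.out : p.Prime).ne_one
  rw [← norm_ne_zero_iff, norm_one_sub_pow_char_pow_mul p h N hm]
  exact pow_ne_zero _ (norm_ne_zero_iff.2 (sub_ne_zero.2 hx.symm))

end Norms

section Setting

open PowerSeries

variable {K : Type*} [NormedField K]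

/-- The hypotheses on `f` in the theorem: the multiplier `λ = a f 0` lies in the residue disc of
`1`, it is not `1`, and some `aᵢ` with `i ≥ 1` does not vanish. -/
structure NearParabolic (f : K⟦X⟧) : Prop where
  exists_ne : ∃ i, 1 ≤ i ∧ a f i ≠ 0
  ne_one : a f 0 ≠ 1
  norm_lt : ‖1 - a f 0‖ < 1

/-- The factor `1 - λ ^ p ^ (l + τ)` in the denominator of `ψ_l`. Its norm, which is
`|μ| ^ p ^ (l + τ)`, is the unit in which the estimates at level `l` are expressed. -/
noncomputable def delta (p : ℕ) (f : K⟦X⟧) (l : ℕ) : K := 1 - a f 0 ^ p ^ (l + tau p f)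

/-- The quotient `φ_l(r, x) / ψ_l(r, x)`, which does not depend on `r`. -/
noncomputable def kappa (p : ℕ) (f : K⟦X⟧) (l x : ℕ) : K :=
  delta p f l * a f 0 ^ (u f * x - 1) / (1 - a f 0 ^ (u f * x))

/-- The sum `φ_{l+1}` with the normalization of `ψ_l`. It interpolates between `ψ_l` and
`ψ_{l+1}`. -/
noncomputable def chi (p : ℕ) (f : K⟦X⟧) (l r s : ℕ) : K :=
  phi p f (l + 1) r s / kappa p f l s

variable {f : K⟦X⟧}

theorem NearParabolic.u_pos (hf : NearParabolic f) : 0 < u f := NonLin.u_pos hf.exists_ne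

theorem NearParabolic.exists_u_eq (hf : NearParabolic f) (p : ℕ) [Fact p.Prime] :
    ∃ v : ℕ, u f = p ^ tau p f * v ∧ ¬ p ∣ v := by
  obtain ⟨v, hv⟩ := pow_padicValNat_dvd (p := p) (n := u f)
  refine ⟨v, hv, ?_⟩
  rintro ⟨w, rfl⟩
  refine pow_succ_padicValNat_not_dvd (p := p) hf.u_pos.ne' ⟨w, ?_⟩
  rwa [pow_succ, mul_assoc]

theorem pow_char_pow_dvd_u_mul {p k T : ℕ} (hT : p ^ k ∣ T) : p ^ (k + tau p f) ∣ u f * T := by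
  rw [pow_add, mul_comm]
  exact mul_dvd_mul pow_padicValNat_dvd hT

theorem NearParabolic.norm_lam [IsUltrametricDist K] (hf : NearParabolic f) : ‖a f 0‖ = 1 :=
  norm_eq_one_of_norm_one_sub_lt hf.norm_lt

theorem NearParabolic.lam_ne_zero [IsUltrametricDist K] (hf : NearParabolic f) : a f 0 ≠ 0 := by
  rw [← norm_ne_zero_iff, hf.norm_lam]
  exact one_ne_zero

theorem NearParabolic.one_sub_ne_zero [IsUltrametricDist K] (hf : NearParabolic f) (p : ℕ)
    [Fact p.Prime] [CharP K p] {n : ℕ} (hn : 0 < n) : 1 - a f 0 ^ n ≠ 0 :=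
  one_sub_pow_ne_zero p hf.ne_one hf.norm_lt hn.ne'

section CharP

variable (p : ℕ) [Fact p.Prime] [CharP K p]

theorem delta_eq (f : K⟦X⟧) (l : ℕ) : delta p f l = (1 - a f 0) ^ p ^ (l + tau p f) := by
  simpa [delta] using one_sub_pow_char_pow_mul p (a f 0) (l + tau p f) 1

theorem delta_eq_pow (f : K⟦X⟧) (l : ℕ) : delta p f l = delta p f 0 ^ p ^ l := by
  rw [delta_eq, delta_eq, zero_add, ← pow_mul, pow_add, mul_comm]

theorem delta_succ (f : K⟦X⟧) (l : ℕ) : delta p f (l + 1) = delta p f l ^ p := by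
  rw [delta_eq_pow, delta_eq_pow p f l, ← pow_mul, pow_succ]

theorem NearParabolic.delta_ne_zero (hf : NearParabolic f) (l : ℕ) : delta p f l ≠ 0 := by
  rw [delta_eq]
  exact pow_ne_zero _ (sub_ne_zero.2 hf.ne_one.symm)

theorem NearParabolic.norm_delta_pos (hf : NearParabolic f) (l : ℕ) : 0 < ‖delta p f l‖ :=
  norm_pos_iff.2 (hf.delta_ne_zero p l)

theorem NearParabolic.norm_delta_lt_one (hf : NearParabolic f) (l : ℕ) : ‖delta p f l‖ < 1 := by
  rw [delta_eq, norm_pow]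
  exact pow_lt_one₀ (norm_nonneg _) hf.norm_lt (pow_ne_zero _ (Fact.out : p.Prime).ne_zero)

variable [IsUltrametricDist K]

theorem NearParabolic.norm_one_sub_le (hf : NearParabolic f) {k T : ℕ} (hT : p ^ k ∣ T) :
    ‖1 - a f 0 ^ (u f * T)‖ ≤ ‖delta p f k‖ := by
  obtain ⟨n, hn⟩ := pow_char_pow_dvd_u_mul (f := f) hT
  rw [hn, delta_eq, norm_pow]
  exact norm_one_sub_pow_char_pow_mul_le p hf.norm_lam.le _ _

theorem NearParabolic.norm_one_sub (hf : NearParabolic f) {l x : ℕ}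
    (hx : p ^ l ∣ x) (hx' : ¬ p ^ (l + 1) ∣ x) :
    ‖1 - a f 0 ^ (u f * x)‖ = ‖delta p f l‖ := by
  obtain ⟨v, hv, hpv⟩ := hf.exists_u_eq p
  obtain ⟨n, rfl⟩ := hx
  rw [pow_succ, Nat.mul_dvd_mul_iff_left (pow_pos (Fact.out : p.Prime).pos _)] at hx'
  rw [hv, show p ^ tau p f * v * (p ^ l * n) = p ^ (l + tau p f) * (v * n) by ring,
    norm_one_sub_pow_char_pow_mul p hf.norm_lt _ ((Fact.out : p.Prime).not_dvd_mul hpv hx'),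
    delta_eq, norm_pow]

theorem NearParabolic.kappa_ne_zero (hf : NearParabolic f) (l : ℕ) {x : ℕ} (hx : 0 < x) :
    kappa p f l x ≠ 0 :=
  div_ne_zero (mul_ne_zero (hf.delta_ne_zero p l) (pow_ne_zero _ hf.lam_ne_zero))
    (hf.one_sub_ne_zero p (mul_pos hf.u_pos hx))

end CharP

variable [IsUltrametricDist K] {p : ℕ} [Fact p.Prime] [CharP K p]

theorem NearParabolic.psi_mul_kappa (hf : NearParabolic f) (l r : ℕ) {s : ℕ} (hs : 0 < s) :
    psi p f l r s * kappa p f l s = phi p f l r s := by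
  have hκ := hf.kappa_ne_zero p l hs
  rw [← eq_div_iff hκ, psi, kappa, div_div_eq_mul_div, mul_div_assoc, delta]

theorem NearParabolic.chi_mul_kappa (hf : NearParabolic f) (l r : ℕ) {s : ℕ} (hs : 0 < s) :
    chi p f l r s * kappa p f l s = phi p f (l + 1) r s :=
  div_mul_cancel₀ _ (hf.kappa_ne_zero p l hs)

theorem NearParabolic.psi_succ_mul_delta (hf : NearParabolic f) (l r : ℕ) {s : ℕ} (hs : 0 < s) :
    psi p f (l + 1) r s * delta p f (l + 1) = chi p f l r s * delta p f l := by
  have hκ (k : ℕ) : kappa p f k s =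
      delta p f k * (a f 0 ^ (u f * s - 1) / (1 - a f 0 ^ (u f * s))) := mul_div_assoc _ _ _
  have h := (hf.psi_mul_kappa (p := p) (l + 1) r hs).trans (hf.chi_mul_kappa l r hs).symm
  rw [hκ, hκ, ← mul_assoc, ← mul_assoc] at h
  exact mul_right_cancel₀ (div_ne_zero (pow_ne_zero _ hf.lam_ne_zero)
    (hf.one_sub_ne_zero p (mul_pos hf.u_pos hs))) h

theorem NearParabolic.chi_eq_psi_add_sum (hf : NearParabolic f) (l : ℕ) {r s : ℕ} (h : r < s) :
    chi p f l r s = psi p f l r s +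
      ∑ x ∈ Finset.Ioo r s with p ^ l ∣ x ∧ ¬ p ^ (l + 1) ∣ x,
        chi p f l r x * kappa p f l x * psi p f l x s := by
  have hs : 0 < s := by lia
  rw [chi, div_eq_iff (hf.kappa_ne_zero p l hs), phi_succ p f l h, add_mul,
    hf.psi_mul_kappa l r hs, Finset.sum_mul]
  congr 1
  refine Finset.sum_congr rfl fun x hx => ?_
  simp only [Finset.mem_filter, Finset.mem_Ioo] at hx
  rw [hf.chi_mul_kappa l r (by lia), mul_assoc, hf.psi_mul_kappa l x hs]

theorem NearParabolic.norm_kappa (hf : NearParabolic f) {l x : ℕ}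
    (hx : p ^ l ∣ x) (hx' : ¬ p ^ (l + 1) ∣ x) : ‖kappa p f l x‖ = 1 := by
  rw [kappa, norm_div, norm_mul, norm_pow, hf.norm_lam, one_pow, mul_one,
    hf.norm_one_sub p hx hx', div_self (hf.norm_delta_pos p l).ne']

theorem NearParabolic.kappa_mul_geom_sum_pow (hf : NearParabolic f) {v : ℕ}
    (hv : u f = p ^ tau p f * v) (l : ℕ) {n : ℕ} (hn : 0 < n) :
    kappa p f l (p ^ l * n) * (∑ j ∈ Finset.range (v * n), a f 0 ^ j) ^ p ^ (l + tau p f) =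
      a f 0 ^ (u f * (p ^ l * n) - 1) := by
  have hden : 1 - a f 0 ^ (u f * (p ^ l * n)) =
      delta p f l * (∑ j ∈ Finset.range (v * n), a f 0 ^ j) ^ p ^ (l + tau p f) := by
    rw [delta_eq, ← mul_pow, mul_neg_geom_sum, ← one_sub_pow_char_pow_mul, hv]
    ring_nf
  have hpos : 0 < u f * (p ^ l * n) :=
    mul_pos hf.u_pos (mul_pos (pow_pos (Fact.out : p.Prime).pos _) hn)
  rw [kappa, div_mul_eq_mul_div, div_eq_iff (hf.one_sub_ne_zero p hpos), hden]
  ring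

/-- Modulo the maximal ideal `λ = 1`, and `κ_l(p ^ l * n)` becomes `1 / (v * n)`. -/
theorem NearParabolic.norm_mul_kappa_sub_one_lt (hf : NearParabolic f) {v : ℕ}
    (hv : u f = p ^ tau p f * v) (l : ℕ) {n : ℕ} (hn : ¬ p ∣ n) :
    ‖((v * n : ℕ) : K) * kappa p f l (p ^ l * n) - 1‖ < 1 := by
  have hn0 : 0 < n := Nat.pos_of_ne_zero fun h => hn (h ▸ dvd_zero p)
  have hκ : ‖kappa p f l (p ^ l * n)‖ = 1 := by
    refine hf.norm_kappa (dvd_mul_right _ _) ?_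
    rwa [pow_succ, Nat.mul_dvd_mul_iff_left (pow_pos (Fact.out : p.Prime).pos _)]
  set G := ∑ j ∈ Finset.range (v * n), a f 0 ^ j
  set P := p ^ (l + tau p f) with hP
  set κ := kappa p f l (p ^ l * n)
  have hsplit : ((v * n : ℕ) : K) * κ - 1 =
      -((G - (v * n : ℕ)) ^ P * κ) - (1 - a f 0 ^ (u f * (p ^ l * n) - 1)) := by
    rw [← hf.kappa_mul_geom_sum_pow hv l hn0, hP, sub_pow_char_pow, natCast_pow_char_pow]
    ring
  rw [hsplit]
  refine norm_sub_lt ?_ (norm_one_sub_pow_lt_one hf.norm_lt _)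
  rw [norm_neg, norm_mul, hκ, mul_one, norm_pow]
  exact pow_lt_one₀ (norm_nonneg _) (norm_geom_sum_sub_natCast_lt_one hf.norm_lt _)
    (pow_ne_zero _ (Fact.out : p.Prime).ne_zero)

theorem NearParabolic.lam_mul_kappa (hf : NearParabolic f) (l : ℕ) {x : ℕ} (hx : 0 < x) :
    a f 0 * kappa p f l x = delta p f l * ((1 - a f 0 ^ (u f * x))⁻¹ - 1) := by
  have hux : 0 < u f * x := mul_pos hf.u_pos hx
  have h1 := hf.one_sub_ne_zero p hux
  rw [kappa, mul_div_assoc', mul_left_comm, mul_pow_sub_one hux.ne']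
  field_simp
  ring

theorem NearParabolic.norm_kappa_shift_le (hf : NearParabolic f) {k l x T : ℕ}
    (hl : l < k) (hx : p ^ l ∣ x) (hx' : ¬ p ^ (l + 1) ∣ x) (hT : p ^ k ∣ T) :
    ‖kappa p f l (x + T) - kappa p f l x‖ ≤ ‖delta p f k‖ / ‖delta p f l‖ := by
  have hlT : p ^ (l + 1) ∣ T := (pow_dvd_pow p hl).trans hT
  have hy : p ^ l ∣ x + T := dvd_add hx ((pow_dvd_pow p l.le_succ).trans hlT)
  have hy' : ¬ p ^ (l + 1) ∣ x + T := by rwa [Nat.dvd_add_left hlT]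
  have hx0 : 0 < x := Nat.pos_of_ne_zero fun h => hx' (h ▸ dvd_zero _)
  have hdiff : a f 0 * (kappa p f l (x + T) - kappa p f l x) =
      delta p f l * (-(a f 0 ^ (u f * x) * (1 - a f 0 ^ (u f * T))) /
        ((1 - a f 0 ^ (u f * (x + T))) * (1 - a f 0 ^ (u f * x)))) := by
    rw [mul_sub, hf.lam_mul_kappa l (by lia), hf.lam_mul_kappa l hx0, ← mul_sub,
      sub_sub_sub_cancel_right, inv_sub_inv (hf.one_sub_ne_zero p (mul_pos hf.u_pos (by lia)))
        (hf.one_sub_ne_zero p (mul_pos hf.u_pos hx0)), mul_add, pow_add]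
    congr 2
    ring
  have hδ := hf.norm_delta_pos p l
  calc ‖kappa p f l (x + T) - kappa p f l x‖
      = ‖a f 0 * (kappa p f l (x + T) - kappa p f l x)‖ := by rw [norm_mul, hf.norm_lam, one_mul]
    _ = ‖1 - a f 0 ^ (u f * T)‖ / ‖delta p f l‖ := by
      rw [hdiff, norm_mul, norm_div, norm_neg, norm_mul, norm_mul, norm_pow, hf.norm_lam, one_pow,
        one_mul, hf.norm_one_sub p hx hx', hf.norm_one_sub p hy hy']
      field_simp
    _ ≤ ‖delta p f k‖ / ‖delta p f l‖ := by
      gcongr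
      exact hf.norm_one_sub_le p hT

end Setting

section Recursion

variable {K : Type*} [NormedField K]

/-- The kernel `w` satisfies `‖w r s‖ ≤ C * σ ^ (s - r)` at the multiples `r < s` of `d`. -/
def KernelBound (d : ℕ) (C σ : ℝ) (w : ℕ → ℕ → K) : Prop :=
  ∀ ⦃r s : ℕ⦄, d ∣ r → d ∣ s → r < s → ‖w r s‖ ≤ C * σ ^ (s - r)

theorem sum_Ioo_add_right {M : Type*} [AddCommMonoid M] (g : ℕ → M) {P : ℕ → Prop}
    [DecidablePred P] {T : ℕ} (hP : ∀ x, P (x + T) ↔ P x) (r s : ℕ) :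
    ∑ x ∈ Finset.Ioo (r + T) (s + T) with P x, g x =
      ∑ x ∈ Finset.Ioo r s with P x, g (x + T) := by
  rw [Finset.sum_filter, Finset.sum_filter, ← Finset.map_add_right_Ioo, Finset.sum_map]
  simp [hP]

theorem norm_mul_mul_sub_mul_mul_le [IsUltrametricDist K] {x x' y y' z z' : K} {A C ε : ℝ}
    (hA : 0 ≤ A) (hxx : ‖x' - x‖ ≤ ε * A) (hx : ‖x‖ ≤ A) (hy' : ‖y'‖ ≤ 1) (hy : ‖y‖ ≤ 1)
    (hyy : ‖y' - y‖ ≤ ε) (hz' : ‖z'‖ ≤ C) (hzz : ‖z' - z‖ ≤ ε * C) :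
    ‖x' * y' * z' - x * y * z‖ ≤ ε * (A * C) := by
  have hε : 0 ≤ ε := (norm_nonneg _).trans hyy
  have hsplit : x' * y' * z' - x * y * z =
      (x' - x) * y' * z' + (x * (y' - y) * z' + x * y * (z' - z)) := by ring
  rw [hsplit]
  refine (IsUltrametricDist.norm_add_le_max _ _).trans (max_le ?_
    ((IsUltrametricDist.norm_add_le_max _ _).trans (max_le ?_ ?_)))
  · calc ‖(x' - x) * y' * z'‖ ≤ ε * A * 1 * C := by
          rw [norm_mul, norm_mul]
          gcongr
      _ = ε * (A * C) := by ring
  · calc ‖x * (y' - y) * z'‖ ≤ A * ε * C := by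
          rw [norm_mul, norm_mul]
          gcongr
      _ = ε * (A * C) := by ring
  · calc ‖x * y * (z' - z)‖ ≤ A * 1 * (ε * C) := by
          rw [norm_mul, norm_mul]
          gcongr
      _ = ε * (A * C) := by ring

variable [IsUltrametricDist K] {χ ψ : ℕ → ℕ → K} {κ : ℕ → K} {d : ℕ} {σ ε : ℝ} {P : ℕ → Prop}
  [DecidablePred P]

theorem KernelBound.of_rec (hσ : 0 ≤ σ) (hP : ∀ x, P x → d ∣ x)
    (hrec : ∀ r s, r < s → χ r s = ψ r s + ∑ x ∈ Finset.Ioo r s with P x, χ r x * κ x * ψ x s)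
    (hκ : ∀ x, P x → ‖κ x‖ ≤ 1) (hψ : KernelBound d 1 σ ψ) : KernelBound d 1 σ χ := by
  intro r s hr hs h
  induction s using Nat.strong_induction_on with
  | _ s ih =>
  rw [hrec r s h]
  refine (IsUltrametricDist.norm_add_le_max _ _).trans (max_le (hψ hr hs h) ?_)
  refine IsUltrametricDist.norm_sum_le_of_forall_le_of_nonneg (by positivity) fun x hx => ?_
  obtain ⟨hx, hPx⟩ := Finset.mem_filter.1 hx
  obtain ⟨hrx, hxs⟩ := Finset.mem_Ioo.1 hx
  calc ‖χ r x * κ x * ψ x s‖ = ‖χ r x‖ * ‖κ x‖ * ‖ψ x s‖ := by rw [norm_mul, norm_mul]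
    _ ≤ 1 * σ ^ (x - r) * 1 * (1 * σ ^ (s - x)) := by
      gcongr
      exacts [ih x hxs (hP x hPx) hrx, hκ x hPx, hψ (hP x hPx) hs hxs]
    _ = 1 * σ ^ (s - r) := by
      rw [← Nat.sub_add_sub_cancel hxs.le hrx.le, pow_add]
      ring

theorem KernelBound.sub_of_rec (hσ : 0 ≤ σ) (hε : 0 ≤ ε) (hP : ∀ x, P x → d ∣ x)
    (hrec : ∀ r s, r < s → χ r s = ψ r s + ∑ x ∈ Finset.Ioo r s with P x, χ r x * κ x * ψ x s)
    (hκ : ∀ x, P x → ‖κ x‖ ≤ 1) (hψ : KernelBound d 1 σ ψ)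
    {T : ℕ} (hT : d ∣ T) (hPT : ∀ x, P (x + T) ↔ P x)
    (hκT : ∀ x, P x → ‖κ (x + T) - κ x‖ ≤ ε)
    (hψT : KernelBound d ε σ fun r s => ψ (r + T) (s + T) - ψ r s) :
    KernelBound d ε σ fun r s => χ (r + T) (s + T) - χ r s := by
  have hχ := hψ.of_rec hσ hP hrec hκ
  intro r s hr hs h
  induction s using Nat.strong_induction_on with
  | _ s ih =>
  simp only
  rw [hrec r s h, hrec (r + T) (s + T) (by lia), sum_Ioo_add_right _ hPT, add_sub_add_comm,
    ← Finset.sum_sub_distrib]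
  refine (IsUltrametricDist.norm_add_le_max _ _).trans (max_le (hψT hr hs h) ?_)
  refine IsUltrametricDist.norm_sum_le_of_forall_le_of_nonneg (by positivity) fun x hx => ?_
  obtain ⟨hx, hPx⟩ := Finset.mem_filter.1 hx
  obtain ⟨hrx, hxs⟩ := Finset.mem_Ioo.1 hx
  have hψx : ‖ψ (x + T) (s + T)‖ ≤ 1 * σ ^ (s - x) := by
    rw [← Nat.add_sub_add_right s T x]
    exact hψ (dvd_add (hP x hPx) hT) (dvd_add hs hT) (Nat.add_lt_add_right hxs T)
  rw [← Nat.sub_add_sub_cancel hxs.le hrx.le, add_comm (s - x), pow_add]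
  refine norm_mul_mul_sub_mul_mul_le (pow_nonneg hσ _) (ih x hxs (hP x hPx) hrx) ?_
    (hκ _ ((hPT x).2 hPx)) (hκ x hPx) (hκT x hPx) ?_ (hψT (hP x hPx) hs hxs)
  · rw [← one_mul (σ ^ _)]
    exact hχ hr (hP x hPx) hrx
  · rw [← one_mul (σ ^ _)]
    exact hψx

end Recursion

section GaussBound

open PowerSeries

variable {K : Type*} [NormedField K]

/-- The bound `‖gₙ‖ ≤ C * σ ^ n` for all `n`, that is, the Gauss norm of `g` on the disc of radius
`σ⁻¹` is at most `C`. -/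
def GaussBound (σ C : ℝ) (g : K⟦X⟧) : Prop := ∀ n, ‖coeff n g‖ ≤ C * σ ^ n

/-- The coefficients of `g` below `N` are strictly smaller than required by `GaussBound σ 1 g`. -/
def SmallBelow (σ : ℝ) (N : ℕ) (g : K⟦X⟧) : Prop := ∀ n < N, ‖coeff n g‖ < σ ^ n

/-- The Gauss norm of `g` on the disc of radius `σ⁻¹` is `1`, and `d` is the last index at which
it is attained: `g` has `d` zeros in that disc by the Weierstrass preparation theorem. -/
structure WeierstrassDegree (σ : ℝ) (d : ℕ) (g : K⟦X⟧) : Prop where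
  bound : GaussBound σ 1 g
  norm_coeff : ‖coeff d g‖ = σ ^ d
  norm_coeff_lt : ∀ n, d < n → ‖coeff n g‖ < σ ^ n

variable {σ C D : ℝ} {g h : K⟦X⟧} {N d e : ℕ}

theorem gaussBound_one (hσ : 0 ≤ σ) : GaussBound σ 1 (1 : K⟦X⟧) := by
  intro n
  rw [coeff_one]
  split_ifs with hn
  · simp [hn]
  · simpa using pow_nonneg hσ n

theorem GaussBound.mono (hσ : 0 ≤ σ) (hg : GaussBound σ C g) (hCD : C ≤ D) : GaussBound σ D g :=
  fun n => (hg n).trans (mul_le_mul_of_nonneg_right hCD (pow_nonneg hσ n))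

theorem weierstrassDegree_one (hσ : 0 < σ) : WeierstrassDegree σ 0 (1 : K⟦X⟧) where
  bound := gaussBound_one hσ.le
  norm_coeff := by simp
  norm_coeff_lt n hn := by simpa [coeff_one, hn.ne'] using pow_pos hσ n

theorem WeierstrassDegree.norm_coeff_mul_lt (hσ : 0 < σ) (hg : WeierstrassDegree σ d g)
    (hh : WeierstrassDegree σ e h) {i j : ℕ} (hij : d < i ∨ e < j) :
    ‖coeff i g * coeff j h‖ < σ ^ (i + j) := by
  have hgi : ‖coeff i g‖ ≤ σ ^ i := by simpa using hg.bound i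
  have hhj : ‖coeff j h‖ ≤ σ ^ j := by simpa using hh.bound j
  rw [norm_mul, pow_add]
  rcases hij with hi | hj
  · exact mul_lt_mul_of_lt_of_le_of_nonneg_of_pos (hg.norm_coeff_lt i hi) hhj (norm_nonneg _)
      (pow_pos hσ j)
  · exact mul_lt_mul' hgi (hh.norm_coeff_lt j hj) (norm_nonneg _) (pow_pos hσ i)

variable [IsUltrametricDist K]

theorem GaussBound.add (hg : GaussBound σ C g) (hh : GaussBound σ C h) :
    GaussBound σ C (g + h) := by
  intro n
  rw [map_add]
  exact (IsUltrametricDist.norm_add_le_max _ _).trans (max_le (hg n) (hh n))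

theorem GaussBound.mul (hσ : 0 ≤ σ) (hC : 0 ≤ C) (hD : 0 ≤ D) (hg : GaussBound σ C g)
    (hh : GaussBound σ D h) : GaussBound σ (C * D) (g * h) := by
  intro n
  rw [coeff_mul]
  refine IsUltrametricDist.norm_sum_le_of_forall_le_of_nonneg (by positivity) fun x hx => ?_
  rw [norm_mul, ← Finset.HasAntidiagonal.mem_antidiagonal.1 hx, pow_add, mul_mul_mul_comm]
  exact mul_le_mul (hg _) (hh _) (norm_nonneg _) (by positivity)

theorem GaussBound.pow (hσ : 0 ≤ σ) (hC : 0 ≤ C) (hg : GaussBound σ C g) (n : ℕ) :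
    GaussBound σ (C ^ n) (g ^ n) := by
  induction n with
  | zero => simpa using gaussBound_one hσ
  | succ n ih =>
    rw [pow_succ, pow_succ]
    exact ih.mul hσ (pow_nonneg hC n) hC hg

theorem GaussBound.of_sub_one (hσ : 0 ≤ σ) (hC : C ≤ 1) (hg : GaussBound σ C (g - 1)) :
    GaussBound σ 1 g := by
  simpa using (hg.mono hσ hC).add (gaussBound_one hσ)

theorem GaussBound.pow_of_one (hσ : 0 ≤ σ) (hg : GaussBound σ 1 g) (n : ℕ) :
    GaussBound σ 1 (g ^ n) := by
  simpa using hg.pow hσ zero_le_one n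

theorem GaussBound.pow_sub_one (hσ : 0 ≤ σ) (hC : 0 ≤ C) (hC1 : C ≤ 1)
    (hg : GaussBound σ C (g - 1)) (n : ℕ) : GaussBound σ C (g ^ n - 1) := by
  induction n with
  | zero =>
    intro n
    simpa using mul_nonneg hC (pow_nonneg hσ n)
  | succ n ih =>
    rw [show g ^ (n + 1) - 1 = g * (g ^ n - 1) + (g - 1) by ring]
    exact (by simpa using (hg.of_sub_one hσ hC1).mul hσ zero_le_one hC ih :
      GaussBound σ C (g * (g ^ n - 1))).add hg

theorem SmallBelow.add (hg : SmallBelow σ N g) (hh : SmallBelow σ N h) : SmallBelow σ N (g + h) :=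
  fun n hn => by
    rw [map_add]
    exact norm_add_lt (hg n hn) (hh n hn)

theorem SmallBelow.sub (hg : SmallBelow σ N g) (hh : SmallBelow σ N h) : SmallBelow σ N (g - h) :=
  fun n hn => by
    rw [map_sub]
    exact norm_sub_lt (hg n hn) (hh n hn)

theorem SmallBelow.mul (hσ : 0 < σ) (hg : GaussBound σ 1 g) (hh : SmallBelow σ N h) :
    SmallBelow σ N (g * h) := by
  intro n hn
  rw [coeff_mul]
  refine norm_sum_lt (by positivity) fun x hx => ?_
  have hx := Finset.HasAntidiagonal.mem_antidiagonal.1 hx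
  calc ‖coeff x.1 g * coeff x.2 h‖ ≤ 1 * σ ^ x.1 * ‖coeff x.2 h‖ := by
        rw [norm_mul]
        exact mul_le_mul_of_nonneg_right (hg _) (norm_nonneg _)
    _ < 1 * σ ^ x.1 * σ ^ x.2 := by
        gcongr
        exact hh x.2 (by lia)
    _ = σ ^ n := by rw [one_mul, ← pow_add, hx]

theorem WeierstrassDegree.mul (hσ : 0 < σ) (hg : WeierstrassDegree σ d g)
    (hh : WeierstrassDegree σ e h) : WeierstrassDegree σ (d + e) (g * h) where
  bound := by simpa using hg.bound.mul hσ.le zero_le_one zero_le_one hh.bound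
  norm_coeff := by
    have hlead : ‖coeff d g * coeff e h‖ = σ ^ (d + e) := by
      rw [norm_mul, hg.norm_coeff, hh.norm_coeff, pow_add]
    rw [coeff_mul, ← hlead]
    refine norm_eq_of_norm_sub_lt ?_
    rw [hlead, ← Finset.add_sum_erase _ _ (a := (d, e))
      (Finset.HasAntidiagonal.mem_antidiagonal.2 rfl), add_sub_cancel_left]
    refine norm_sum_lt (pow_pos hσ _) fun x hx => ?_
    obtain ⟨hne, hx⟩ := Finset.mem_erase.1 hx
    rw [Finset.HasAntidiagonal.mem_antidiagonal] at hx
    rw [← hx]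
    refine hg.norm_coeff_mul_lt hσ hh ?_
    by_contra! hle
    exact hne (Prod.ext (by lia) (by lia))
  norm_coeff_lt n hn := by
    rw [coeff_mul]
    refine norm_sum_lt (pow_pos hσ _) fun x hx => ?_
    rw [Finset.HasAntidiagonal.mem_antidiagonal] at hx
    rw [← hx]
    exact hg.norm_coeff_mul_lt hσ hh (by lia)

theorem WeierstrassDegree.add (hg : WeierstrassDegree σ d g) (hh : GaussBound σ 1 h)
    (hlt : ∀ n, d ≤ n → ‖coeff n h‖ < σ ^ n) : WeierstrassDegree σ d (g + h) where
  bound := hg.bound.add hh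
  norm_coeff := by
    rw [← hg.norm_coeff, map_add]
    refine norm_eq_of_norm_sub_lt ?_
    rw [add_sub_cancel_left, hg.norm_coeff]
    exact hlt d le_rfl
  norm_coeff_lt n hn := by
    rw [map_add]
    exact norm_add_lt (hg.norm_coeff_lt n hn) (hlt n hn.le)

end GaussBound

section EulerOperator

open PowerSeries

section CommRing

variable {R : Type*} [CommRing R]

/-- The Euler operator `X * d/dX` on power series. -/
noncomputable def euler (R : Type*) [CommRing R] : Derivation R R⟦X⟧ R⟦X⟧ :=
  (X : R⟦X⟧) • derivative R

theorem coeff_euler (g : R⟦X⟧) (n : ℕ) : coeff n (euler R g) = n * coeff n g := by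
  rw [euler, Derivation.smul_apply, smul_eq_mul]
  cases n with
  | zero => simp
  | succ n =>
    rw [coeff_succ_X_mul, coeff_derivative, mul_comm, Nat.cast_succ]

theorem coeff_euler_iterate (g : R⟦X⟧) (j n : ℕ) :
    coeff n ((euler R)^[j] g) = (n : R) ^ j * coeff n g := by
  induction j with
  | zero => simp
  | succ j ih => rw [Function.iterate_succ_apply', coeff_euler, ih, pow_succ', mul_assoc]

theorem euler_iterate_char (p : ℕ) [Fact p.Prime] [CharP R p] (g : R⟦X⟧) :
    (euler R)^[p] g = euler R g := by
  ext n
  rw [coeff_euler_iterate, coeff_euler, ← frobenius_def, map_natCast]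

/-- The series `Wⱼ` for which `euler Y = W * Y` implies `euler^[j] Y = Wⱼ * Y`. -/
noncomputable def eulerIter (W : R⟦X⟧) : ℕ → R⟦X⟧
  | 0 => 1
  | j + 1 => W * eulerIter W j + euler R (eulerIter W j)

end CommRing

variable {K : Type*} [NormedField K] [IsUltrametricDist K] {σ : ℝ} {N d e : ℕ} {g h W Y : K⟦X⟧}

theorem norm_coeff_euler_le (g : K⟦X⟧) (n : ℕ) : ‖coeff n (euler K g)‖ ≤ ‖coeff n g‖ := by
  rw [coeff_euler, norm_mul]
  exact mul_le_of_le_one_left (norm_nonneg _) (IsUltrametricDist.norm_natCast_le_one K n)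

theorem SmallBelow.euler (hg : SmallBelow σ N g) : SmallBelow σ N (euler K g) :=
  fun n hn => (norm_coeff_euler_le g n).trans_lt (hg n hn)

theorem SmallBelow.of_mul (hσ : 0 < σ) (hh0 : constantCoeff h = 1) (hh : GaussBound σ 1 h)
    (hgh : SmallBelow σ N (g * h)) : SmallBelow σ N g := by
  intro n hn
  induction n using Nat.strong_induction_on with
  | _ n ih =>
  have hsplit : coeff n g = coeff n (g * h) -
      ∑ x ∈ (Finset.HasAntidiagonal.antidiagonal n).erase (n, 0), coeff x.1 g * coeff x.2 h := by
    rw [coeff_mul, ← Finset.add_sum_erase _ _ (a := (n, 0))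
      (Finset.HasAntidiagonal.mem_antidiagonal.2 (add_zero n)), coeff_zero_eq_constantCoeff_apply,
      hh0, mul_one, add_sub_cancel_right]
  rw [hsplit]
  refine norm_sub_lt (hgh n hn) (norm_sum_lt (pow_pos hσ _) fun x hx => ?_)
  rw [Finset.mem_erase, Finset.HasAntidiagonal.mem_antidiagonal, Ne, Prod.ext_iff] at hx
  obtain ⟨hne, hx⟩ := hx
  calc ‖coeff x.1 g * coeff x.2 h‖ ≤ ‖coeff x.1 g‖ * (1 * σ ^ x.2) := by
        rw [norm_mul]
        exact mul_le_mul_of_nonneg_left (hh _) (norm_nonneg _)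
    _ < σ ^ x.1 * (1 * σ ^ x.2) := by
        gcongr
        exact ih x.1 (by simp only at hne; lia) (by lia)
    _ = σ ^ n := by rw [one_mul, ← pow_add, hx]

theorem WeierstrassDegree.eulerIter (hσ : 0 < σ) (he : 0 < e) (hW : WeierstrassDegree σ e W)
    (j : ℕ) : WeierstrassDegree σ (j * e) (eulerIter W j) := by
  induction j with
  | zero => simpa using! weierstrassDegree_one hσ
  | succ j ih =>
    have hmul := hW.mul hσ ih
    rw [add_comm, ← Nat.succ_mul] at hmul
    refine hmul.add (fun n => (norm_coeff_euler_le _ n).trans (ih.bound n)) fun n hn => ?_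
    refine (norm_coeff_euler_le _ n).trans_lt (ih.norm_coeff_lt n ?_)
    rw [Nat.succ_mul] at hn
    lia

theorem SmallBelow.euler_iterate_sub (hσ : 0 < σ) (hW : ∀ j, GaussBound σ 1 (eulerIter W j))
    (hY : SmallBelow σ N (NonLin.euler K Y - W * Y)) (j : ℕ) :
    SmallBelow σ N ((NonLin.euler K)^[j] Y - eulerIter W j * Y) := by
  induction j with
  | zero =>
    intro n _
    simpa [eulerIter] using pow_pos hσ n
  | succ j ih =>
    have hstep : (NonLin.euler K)^[j + 1] Y - eulerIter W (j + 1) * Y =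
        NonLin.euler K ((NonLin.euler K)^[j] Y - eulerIter W j * Y) +
          eulerIter W j * (NonLin.euler K Y - W * Y) := by
      rw [Function.iterate_succ_apply', map_sub, Derivation.leibniz, eulerIter, smul_eq_mul,
        smul_eq_mul]
      ring
    rw [hstep]
    exact ih.euler.add (hY.mul hσ (hW j))

/-- Iterating `euler Y = W * Y` gives `euler Y = euler^[p] Y = Wₚ * Y`, hence `W = Wₚ`, although
`Wₚ` has Weierstrass degree `p * e` when `W` has Weierstrass degree `e`. -/
theorem WeierstrassDegree.not_smallBelow_euler_sub (p : ℕ) [Fact p.Prime] [CharP K p] (hσ : 0 < σ)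
    (he : 0 < e) (hep : e < p) (hW : WeierstrassDegree σ e W) (hY0 : constantCoeff Y = 1)
    (hY : GaussBound σ 1 Y) : ¬ SmallBelow σ (p ^ 2) (euler K Y - W * Y) := by
  intro hsmall
  have hiter := hsmall.sub (hsmall.euler_iterate_sub hσ (fun j => (hW.eulerIter hσ he j).bound) p)
  rw [euler_iterate_char p, sub_sub_sub_cancel_left, ← sub_mul] at hiter
  have hp : 1 < p := (Fact.out : p.Prime).one_lt
  have hlt := hiter.of_mul hσ hY0 hY (p * e) (by rw [pow_two]; gcongr)
  rw [map_sub, norm_eq_of_norm_sub_lt, (hW.eulerIter hσ he p).norm_coeff] at hlt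
  · exact hlt.false
  · rw [sub_sub_cancel_left, norm_neg, (hW.eulerIter hσ he p).norm_coeff]
    exact hW.norm_coeff_lt _ (lt_mul_of_one_lt_left he hp)

end EulerOperator

section Shift

open PowerSeries

variable {K : Type*} [NormedField K]

/-- The power series `f(z) / (λ z)`, whose powers have the `ψ₀(r, s)` as coefficients, up to
units and a common factor. -/
noncomputable def normalized (f : K⟦X⟧) : K⟦X⟧ := C (a f 0)⁻¹ * mk (a f)

variable {f : K⟦X⟧} [IsUltrametricDist K] {p : ℕ} [Fact p.Prime] [CharP K p]

theorem NearParabolic.psi_zero_mul (hf : NearParabolic f) {r s : ℕ} (h : r < s) :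
    psi p f 0 r s * (delta p f 0 * a f 0 ^ (u f * (s - r) - 1)) =
      coeff (u f * (s - r)) (normalized f ^ (u f * r + 1)) := by
  have hs : 0 < u f * s := mul_pos hf.u_pos (by lia)
  have hsr : 0 < u f * (s - r) := mul_pos hf.u_pos (by lia)
  have hlam := hf.lam_ne_zero
  have hδ := hf.delta_ne_zero p 0
  have hden := hf.one_sub_ne_zero p hs
  have hexp : a f 0 ^ (u f * (s - r) - 1) * a f 0 ^ (u f * r + 1) =
      a f 0 * a f 0 ^ (u f * s - 1) := by
    rw [mul_pow_sub_one hs.ne', ← pow_add]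
    congr 1
    rw [Nat.mul_sub] at hsr ⊢
    lia
  rw [psi, phi_zero p f h, Phi_eq hf.exists_ne, ← Nat.mul_sub, normalized, mul_pow, ← map_pow,
    coeff_C_mul, ← delta, inv_pow, eq_inv_mul_iff_mul_eq₀ (pow_ne_zero _ hlam)]
  generalize coeff (u f * (s - r)) (PowerSeries.mk (a f) ^ (u f * r + 1)) = A
  generalize 1 - a f 0 ^ (u f * s) = D at *
  generalize a f 0 ^ (u f * (s - r) - 1) = P at *
  have hQ := pow_ne_zero (u f * s - 1) hlam
  generalize a f 0 ^ (u f * s - 1) = Q at *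
  calc _ = (P * a f 0 ^ (u f * r + 1)) * A * delta p f 0 * D / (a f 0 * D * delta p f 0 * Q) := by
        ring
    _ = A := by
        rw [hexp]
        field_simp

variable {σ ρ : ℝ}

theorem NearParabolic.gaussBound_normalized_sub_one (hf : NearParabolic f) (hρ : 0 < ρ)
    (hψ : KernelBound 1 1 (ρ ^ u f) (psi p f 0)) :
    GaussBound ρ ‖delta p f 0‖ (normalized f - 1) := by
  intro n
  have hlam := hf.lam_ne_zero
  rcases Nat.eq_zero_or_pos n with rfl | hn
  · simp [normalized, coeff_zero_eq_constantCoeff_apply, hlam]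
  by_cases hn0 : a f n = 0
  · simp only [normalized, map_sub, coeff_C_mul, coeff_mk, hn0, mul_zero, coeff_one, if_neg hn.ne',
      sub_zero, norm_zero]
    positivity
  obtain ⟨j, rfl⟩ := u_dvd hf.exists_ne hn hn0
  have hj : 0 < j := Nat.pos_of_mul_pos_left hn
  have hcoeff := hf.psi_zero_mul (p := p) hj
  rw [mul_zero, zero_add, pow_one, Nat.sub_zero] at hcoeff
  rw [map_sub, coeff_one, if_neg hn.ne', sub_zero, ← hcoeff, norm_mul, norm_mul, norm_pow,
    hf.norm_lam, one_pow, mul_one, mul_comm, pow_mul]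
  gcongr
  simpa using hψ (one_dvd 0) (one_dvd j) hj

theorem NearParabolic.gaussBound_normalized_pow_sub_one (hf : NearParabolic f) (hρ : 0 < ρ)
    (hψ : KernelBound 1 1 (ρ ^ u f) (psi p f 0)) {k T : ℕ} (hT : p ^ k ∣ T) :
    GaussBound ρ ‖delta p f k‖ (normalized f ^ (u f * T) - 1) := by
  have := charP_of_injective_algebraMap (algebraMap K K⟦X⟧).injective p
  obtain ⟨n, rfl⟩ := hT
  have hpow := ((hf.gaussBound_normalized_sub_one hρ hψ).pow_sub_one hρ.le (norm_nonneg _)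
    (hf.norm_delta_lt_one p 0).le (u f * n)).pow hρ.le (norm_nonneg _) (p ^ k)
  rwa [sub_pow_char_pow, one_pow, ← pow_mul, ← norm_pow, ← delta_eq_pow, mul_assoc,
    mul_comm n] at hpow

theorem NearParabolic.psi_zero_shift (hf : NearParabolic f) (hσ : 0 < σ)
    (hψ : KernelBound 1 1 σ (psi p f 0)) {k T : ℕ} (hT : p ^ k ∣ T) :
    KernelBound 1 (‖delta p f k‖ / ‖delta p f 0‖) σ
      fun r s => psi p f 0 (r + T) (s + T) - psi p f 0 r s := by
  obtain ⟨ρ, hρ, rfl⟩ : ∃ ρ : ℝ, 0 < ρ ∧ ρ ^ u f = σ :=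
    ⟨σ ^ (u f : ℝ)⁻¹, by positivity, Real.rpow_inv_natCast_pow hσ.le hf.u_pos.ne'⟩
  intro r s _ _ h
  have hg1 := hf.gaussBound_normalized_sub_one hρ hψ
  have hg := (hg1.of_sub_one hρ.le (hf.norm_delta_lt_one p 0).le).pow_of_one hρ.le (u f * r + 1)
  have hgT := hg.mul hρ.le zero_le_one (norm_nonneg _)
    (hf.gaussBound_normalized_pow_sub_one hρ hψ hT) (u f * (s - r))
  have hdiff : (psi p f 0 (r + T) (s + T) - psi p f 0 r s) *
      (delta p f 0 * a f 0 ^ (u f * (s - r) - 1)) = coeff (u f * (s - r))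
        (normalized f ^ (u f * r + 1) * (normalized f ^ (u f * T) - 1)) := by
    have hrT := hf.psi_zero_mul (p := p) (Nat.add_lt_add_right h T)
    rw [Nat.add_sub_add_right] at hrT
    rw [sub_mul, hrT, hf.psi_zero_mul h, mul_sub, mul_one, ← pow_add, map_sub]
    ring_nf
  rw [← hdiff, norm_mul, norm_mul, norm_pow, hf.norm_lam, one_pow, mul_one, one_mul, pow_mul] at hgT
  simp only
  rwa [div_mul_eq_mul_div, le_div_iff₀ (hf.norm_delta_pos p 0)]

theorem NearParabolic.norm_psi_succ_mul (hf : NearParabolic f) (l r : ℕ) {s : ℕ} (hs : 0 < s) :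
    ‖psi p f (l + 1) r s‖ * ‖delta p f (l + 1)‖ = ‖chi p f l r s‖ * ‖delta p f l‖ := by
  rw [← norm_mul, hf.psi_succ_mul_delta l r hs, norm_mul]

theorem NearParabolic.chi_kernelBound (hf : NearParabolic f) {l : ℕ} (hσ : 0 ≤ σ)
    (hψ : KernelBound (p ^ l) 1 σ (psi p f l)) : KernelBound (p ^ l) 1 σ (chi p f l) :=
  hψ.of_rec hσ (fun _ hx => hx.1) (fun _ _ => hf.chi_eq_psi_add_sum l)
    fun _ hx => (hf.norm_kappa hx.1 hx.2).le

theorem NearParabolic.psi_shift (hf : NearParabolic f) {k T : ℕ} (hT : p ^ k ∣ T) (hσ : 0 < σ)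
    {l : ℕ} (hk : 0 < k)
    (hψ : ∀ i < k, KernelBound (p ^ i) 1 σ (psi p f i)) (hl : l ≤ k) :
    KernelBound (p ^ l) (‖delta p f k‖ / ‖delta p f l‖) σ
      fun r s => psi p f l (r + T) (s + T) - psi p f l r s := by
  induction l with
  | zero => exact hf.psi_zero_shift hσ (by simpa using hψ 0 hk) hT
  | succ l ih =>
    have hlT : p ^ (l + 1) ∣ T := (pow_dvd_pow p hl).trans hT
    have hlT' : p ^ l ∣ T := (pow_dvd_pow p l.le_succ).trans hlT
    have hχ := (hψ l hl).sub_of_rec hσ.le (by positivity) (fun _ hx => hx.1)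
      (fun _ _ => hf.chi_eq_psi_add_sum l) (fun _ hx => (hf.norm_kappa hx.1 hx.2).le)
      hlT' (fun x => by rw [Nat.dvd_add_left hlT', Nat.dvd_add_left hlT])
      (fun _ hx => hf.norm_kappa_shift_le hl hx.1 hx.2 hT) (ih (Nat.le_of_succ_le hl))
    intro r s hr hs h
    have hδ := hf.norm_delta_pos p (l + 1)
    have hδ' := hf.norm_delta_pos p l
    have hle := hχ ((pow_dvd_pow p l.le_succ).trans hr) ((pow_dvd_pow p l.le_succ).trans hs) h
    have hmul : (psi p f (l + 1) (r + T) (s + T) - psi p f (l + 1) r s) * delta p f (l + 1) =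
        (chi p f l (r + T) (s + T) - chi p f l r s) * delta p f l := by
      rw [sub_mul, sub_mul, hf.psi_succ_mul_delta l _ (by lia), hf.psi_succ_mul_delta l r (by lia)]
    replace hmul := congrArg norm hmul
    rw [norm_mul, norm_mul] at hmul
    simp only at hle ⊢
    rw [div_mul_eq_mul_div, le_div_iff₀ hδ, hmul]
    rwa [div_mul_eq_mul_div, le_div_iff₀ hδ'] at hle

end Shift

section DominantRates

open PowerSeries

variable {K : Type*} [NormedField K]

/-- Dominance at level `k + 1` in terms of growth rates: `σ = |μ| ^ m` for a common lower bound `m`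
of `M_0, …, M_k`, and `σ' = |μ| ^ m'` for the least slope `m'` of `ψ_{k+1}(0, d p^(k+1))`,
`1 ≤ d < p`. The field `gap` is `m' ≤ m - p^(τ-1)`, multiplied by `p` to avoid real exponents. -/
structure DominantRates (p : ℕ) (f : K⟦X⟧) (k : ℕ) (σ σ' : ℝ) : Prop where
  pos : 0 < σ
  pos' : 0 < σ'
  bound : ∀ l < k + 1, KernelBound (p ^ l) 1 σ (psi p f l)
  gap : σ ^ p ≤ ‖delta p f 0‖ * σ' ^ p
  le : ∀ d ∈ Finset.Icc 1 (p - 1),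
    ‖psi p f (k + 1) 0 (p ^ (k + 1) * d)‖ ≤ σ' ^ (p ^ (k + 1) * d)
  attained : ∃ d ∈ Finset.Icc 1 (p - 1),
    ‖psi p f (k + 1) 0 (p ^ (k + 1) * d)‖ = σ' ^ (p ^ (k + 1) * d)

theorem exists_norm_le_pow {ι : Type*} {s : Finset ι} {x : ι → K} {D : ι → ℕ}
    (hD : ∀ i ∈ s, D i ≠ 0) (hx : ∃ i ∈ s, x i ≠ 0) :
    ∃ σ : ℝ, 0 < σ ∧ (∀ i ∈ s, ‖x i‖ ≤ σ ^ D i) ∧ ∃ i ∈ s, ‖x i‖ = σ ^ D i := by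
  obtain ⟨i, hi, hxi⟩ := hx
  obtain ⟨j, hj, hmax⟩ := s.exists_max_image (fun i => ‖x i‖ ^ (D i : ℝ)⁻¹) ⟨i, hi⟩
  refine ⟨‖x j‖ ^ (D j : ℝ)⁻¹, ?_, fun i hi => ?_, j, hj, ?_⟩
  · exact (Real.rpow_pos_of_pos (norm_pos_iff.2 hxi) _).trans_le (hmax i hi)
  · rw [← Real.rpow_inv_natCast_pow (norm_nonneg (x i)) (hD i hi)]
    gcongr
    exact hmax i hi
  · rw [Real.rpow_inv_natCast_pow (norm_nonneg (x j)) (hD j hj)]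

theorem DominantRates.of_exists {p : ℕ} [Fact p.Prime] {f : K⟦X⟧} {k : ℕ} {σ : ℝ} (hσ : 0 < σ)
    (hbound : ∀ l < k + 1, KernelBound (p ^ l) 1 σ (psi p f l))
    (hd : ∃ d ∈ Finset.Icc 1 (p - 1), σ ^ (p ^ (k + 1) * d) ≤
      ‖delta p f 0‖ ^ (p ^ k * d) * ‖psi p f (k + 1) 0 (p ^ (k + 1) * d)‖) :
    ∃ σ', DominantRates p f k σ σ' := by
  have hp := (Fact.out : p.Prime).ne_zero
  obtain ⟨d, hd, hle⟩ := hd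
  have hne : psi p f (k + 1) 0 (p ^ (k + 1) * d) ≠ 0 := by
    intro h0
    rw [h0, norm_zero, mul_zero] at hle
    exact (pow_pos hσ _).not_ge hle
  obtain ⟨σ', hσ', hmax, hatt⟩ := exists_norm_le_pow (s := Finset.Icc 1 (p - 1))
    (x := fun d => psi p f (k + 1) 0 (p ^ (k + 1) * d)) (D := fun d => p ^ (k + 1) * d)
    (fun d hd => mul_ne_zero (pow_ne_zero _ hp) (Nat.one_le_iff_ne_zero.1 (Finset.mem_Icc.1 hd).1))
    ⟨d, hd, hne⟩
  refine ⟨σ', hσ, hσ', hbound, ?_, hmax, hatt⟩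
  have hd0 : p ^ k * d ≠ 0 :=
    mul_ne_zero (pow_ne_zero _ hp) (Nat.one_le_iff_ne_zero.1 (Finset.mem_Icc.1 hd).1)
  rw [← pow_le_pow_iff_left₀ (by positivity) (by positivity) hd0]
  calc (σ ^ p) ^ (p ^ k * d) = σ ^ (p ^ (k + 1) * d) := by ring
    _ ≤ ‖delta p f 0‖ ^ (p ^ k * d) * σ' ^ (p ^ (k + 1) * d) := by
      refine hle.trans ?_
      gcongr
      exact hmax d hd
    _ = (‖delta p f 0‖ * σ' ^ p) ^ (p ^ k * d) := by ring

variable {f : K⟦X⟧} {p : ℕ} [Fact p.Prime] [CharP K p] {k : ℕ} {σ σ' : ℝ}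

theorem DominantRates.lt (h : DominantRates p f k σ σ') (hf : NearParabolic f) : σ < σ' := by
  refine lt_of_pow_lt_pow_left₀ p h.pos'.le (h.gap.trans_lt ?_)
  exact mul_lt_of_lt_one_left (pow_pos h.pos' p) (hf.norm_delta_lt_one p 0)

variable [IsUltrametricDist K]

theorem DominantRates.norm_psi_lt (h : DominantRates p f k σ σ') (hf : NearParabolic f) {r s : ℕ}
    (hr : p ^ (k + 1) ∣ r) (hs : p ^ (k + 1) ∣ s) (hrs : r + p ^ (k + 2) ≤ s) :
    ‖psi p f (k + 1) r s‖ < σ' ^ (s - r) := by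
  have hlt : r < s := (Nat.lt_add_of_pos_right (pow_pos (Fact.out : p.Prime).pos _)).trans_le hrs
  have hdvd : p ^ k ∣ p ^ (k + 1) := pow_dvd_pow p k.le_succ
  have hδ := hf.norm_delta_pos p (k + 1)
  obtain ⟨j, hj⟩ : p ∣ s - r := (dvd_pow_self p k.succ_ne_zero).trans (Nat.dvd_sub hs hr)
  have hjle : p ^ (k + 1) ≤ j := by
    refine le_of_mul_le_mul_left ?_ (Fact.out : p.Prime).pos
    rw [← hj, ← pow_succ']
    lia
  have hσ : σ ^ (s - r) ≤ ‖delta p f (k + 1)‖ * σ' ^ (s - r) := by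
    calc σ ^ (s - r) ≤ (‖delta p f 0‖ * σ' ^ p) ^ j := by
          rw [hj, pow_mul]
          exact pow_le_pow_left₀ (pow_pos h.pos p).le h.gap j
      _ ≤ ‖delta p f 0‖ ^ p ^ (k + 1) * σ' ^ (s - r) := by
          rw [hj, mul_pow, ← pow_mul]
          gcongr ?_ * _
          · exact (pow_pos h.pos' _).le
          · exact pow_le_pow_of_le_one (norm_nonneg _) (hf.norm_delta_lt_one p 0).le hjle
      _ = ‖delta p f (k + 1)‖ * σ' ^ (s - r) := by rw [delta_eq_pow p f (k + 1), norm_pow]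
  have hχ := hf.chi_kernelBound h.pos.le (h.bound k k.lt_succ_self) (hdvd.trans hr) (hdvd.trans hs)
    hlt
  rw [one_mul] at hχ
  refine lt_of_mul_lt_mul_right ?_ hδ.le
  calc ‖psi p f (k + 1) r s‖ * ‖delta p f (k + 1)‖ = ‖chi p f k r s‖ * ‖delta p f k‖ :=
        hf.norm_psi_succ_mul k r (by lia)
    _ ≤ ‖delta p f (k + 1)‖ * σ' ^ (s - r) * ‖delta p f k‖ := by
        gcongr
        exact hχ.trans hσ
    _ < ‖delta p f (k + 1)‖ * σ' ^ (s - r) :=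
        mul_lt_of_lt_one_right (mul_pos hδ (pow_pos h.pos' _)) (hf.norm_delta_lt_one p k)
    _ = σ' ^ (s - r) * ‖delta p f (k + 1)‖ := mul_comm _ _

theorem DominantRates.norm_psi_shift_sub_lt (h : DominantRates p f k σ σ') (hf : NearParabolic f)
    {r s T : ℕ} (hr : p ^ (k + 1) ∣ r) (hs : p ^ (k + 1) ∣ s) (hT : p ^ (k + 1) ∣ T)
    (hrs : r < s) :
    ‖psi p f (k + 1) (r + T) (s + T) - psi p f (k + 1) r s‖ < σ' ^ (s - r) := by
  have hle := hf.psi_shift hT h.pos k.succ_pos h.bound le_rfl hr hs hrs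
  rw [div_self (hf.norm_delta_pos p (k + 1)).ne', one_mul] at hle
  exact hle.trans_lt (pow_lt_pow_left₀ (h.lt hf) h.pos.le (Nat.sub_ne_zero_of_lt hrs))

theorem DominantRates.kernelBound (h : DominantRates p f k σ σ') (hf : NearParabolic f) :
    KernelBound (p ^ (k + 1)) 1 σ' (psi p f (k + 1)) := by
  intro r s hr hs hrs
  rw [one_mul]
  by_cases hlarge : r + p ^ (k + 2) ≤ s
  · exact (h.norm_psi_lt hf hr hs hlarge).le
  have hP : 0 < p ^ (k + 1) := pow_pos (Fact.out : p.Prime).pos _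
  obtain ⟨d, hd⟩ : p ^ (k + 1) ∣ s - r := Nat.dvd_sub hs hr
  obtain rfl : s = p ^ (k + 1) * d + r := by lia
  have hd0 : 0 < d := Nat.pos_of_ne_zero fun h0 => by simp [h0] at hrs
  have hdp : d < p := by
    rw [pow_succ, not_le, add_comm, Nat.add_lt_add_iff_left] at hlarge
    exact lt_of_mul_lt_mul_left hlarge hP.le
  have hshift := h.norm_psi_shift_sub_lt hf (dvd_zero _) (dvd_mul_right _ d) hr (mul_pos hP hd0)
  rw [zero_add, Nat.sub_zero] at hshift
  rw [Nat.add_sub_cancel]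
  rw [← sub_add_cancel (psi p f (k + 1) r _) (psi p f (k + 1) 0 (p ^ (k + 1) * d))]
  exact (IsUltrametricDist.norm_add_le_max _ _).trans
    (max_le hshift.le (h.le d (Finset.mem_Icc.2 ⟨hd0, by lia⟩)))

end DominantRates

section Slope

open PowerSeries

variable {K : Type*} [NormedField K] {f : K⟦X⟧} {p k r s : ℕ}

theorem slope_of_ne_zero (hψ : psi p f k r s ≠ 0) :
    slope p f k r s =
      ((Real.logb ‖1 - a f 0‖ ‖psi p f k r s‖ / ((s : ℝ) - r) : ℝ) : EReal) := by
  rw [slope, valMu, if_neg hψ, norm_sub_rev, EReal.coe_div]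
  rfl

theorem slope_of_eq_zero (h : r < s) (hψ : psi p f k r s = 0) : slope p f k r s = ⊤ := by
  rw [slope, valMu, if_pos hψ]
  refine EReal.top_div_of_pos_ne_top ?_ (EReal.coe_ne_top _)
  exact EReal.coe_pos.2 (sub_pos.2 (Nat.cast_lt.2 h))

theorem slope_ne_bot (h : r < s) : slope p f k r s ≠ ⊥ := by
  by_cases hψ : psi p f k r s = 0
  · rw [slope_of_eq_zero h hψ]
    exact top_ne_bot
  · rw [slope_of_ne_zero hψ]
    exact EReal.coe_ne_bot _

theorem NearParabolic.norm_one_sub_lam_pos (hf : NearParabolic f) : 0 < ‖1 - a f 0‖ :=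
  norm_pos_iff.2 (sub_ne_zero.2 hf.ne_one.symm)

theorem NearParabolic.norm_psi_le_of_le_slope (hf : NearParabolic f) (h : r < s) {m : ℝ}
    (hm : (m : EReal) ≤ slope p f k r s) :
    ‖psi p f k r s‖ ≤ (‖1 - a f 0‖ ^ m) ^ (s - r) := by
  by_cases hψ : psi p f k r s = 0
  · rw [hψ, norm_zero]
    positivity
  rwa [slope_of_ne_zero hψ, EReal.coe_le_coe_iff, ← Nat.cast_sub h.le,
    le_div_iff₀ (Nat.cast_pos.2 (Nat.sub_pos_of_lt h)),
    Real.le_logb_iff_rpow_le_of_base_lt_one hf.norm_one_sub_lam_pos hf.norm_lt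
      (norm_pos_iff.2 hψ), Real.rpow_mul_natCast (norm_nonneg _)] at hm

theorem NearParabolic.le_norm_psi_of_slope_le (hf : NearParabolic f) (h : r < s) {m : ℝ}
    (hm : slope p f k r s ≤ (m : EReal)) :
    (‖1 - a f 0‖ ^ m) ^ (s - r) ≤ ‖psi p f k r s‖ := by
  by_cases hψ : psi p f k r s = 0
  · rw [slope_of_eq_zero h hψ] at hm
    exact absurd (top_le_iff.1 hm) (EReal.coe_ne_top _)
  rwa [slope_of_ne_zero hψ, EReal.coe_le_coe_iff, ← Nat.cast_sub h.le,
    div_le_iff₀ (Nat.cast_pos.2 (Nat.sub_pos_of_lt h)),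
    Real.logb_le_iff_le_rpow_of_base_lt_one hf.norm_one_sub_lam_pos hf.norm_lt
      (norm_pos_iff.2 hψ), Real.rpow_mul_natCast (norm_nonneg _)] at hm

variable [IsUltrametricDist K] [Fact p.Prime] [CharP K p]

theorem NearParabolic.M_zero_ne_top (hf : NearParabolic f) : M p f 0 ≠ ⊤ := by
  obtain ⟨n, hn, ha⟩ := hf.exists_ne
  obtain ⟨j, rfl⟩ := u_dvd hf.exists_ne hn ha
  have hj : 0 < j := Nat.pos_of_mul_pos_left hn
  have hψ : psi p f 0 0 j ≠ 0 := by
    refine left_ne_zero_of_mul (b := delta p f 0 * a f 0 ^ (u f * (j - 0) - 1)) ?_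
    rw [hf.psi_zero_mul hj]
    simpa [normalized, hf.lam_ne_zero] using ha
  have hle : M p f 0 ≤ slope p f 0 0 j := sInf_le ⟨0, j, by simp, by simp, hj, rfl⟩
  rw [slope_of_ne_zero hψ] at hle
  exact ne_top_of_le_ne_top (EReal.coe_ne_top _) hle

theorem Dominant.exists_slope_le (hf : NearParabolic f) (hdom : Dominant p f (k + 1)) :
    ∃ m : ℝ, (∀ l < k + 1, (m : EReal) ≤ M p f l) ∧ ∃ d ∈ Finset.Icc 1 (p - 1),
      slope p f (k + 1) 0 (p ^ (k + 1) * d) ≤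
        ((m - (p : ℝ) ^ ((tau p f : ℤ) - 1) : ℝ) : EReal) := by
  have hp := (Fact.out : p.Prime).two_le
  rw [Dominant, ← Finset.inf_eq_iInf] at hdom
  obtain ⟨d, hd, hinf⟩ := Finset.exists_mem_eq_inf (Finset.Icc 1 (p - 1))
    ⟨1, Finset.mem_Icc.2 ⟨le_rfl, by lia⟩⟩ (fun d => slope p f (k + 1) 0 (d * p ^ (k + 1)))
  rw [hinf, mul_comm] at hdom
  have hpos : 0 < p ^ (k + 1) * d := by
    have := (Finset.mem_Icc.1 hd).1
    positivity
  generalize hR : ⨅ l ∈ Finset.range (k + 1), M p f l = R at hdom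
  have hle (l : ℕ) (hl : l < k + 1) : R ≤ M p f l := hR ▸ iInf₂_le l (Finset.mem_range.2 hl)
  have htop : R ≠ ⊤ := ne_top_of_le_ne_top (hf.M_zero_ne_top (p := p)) (hle 0 k.succ_pos)
  have hbot : R ≠ ⊥ := by
    rintro rfl
    rw [EReal.bot_sub] at hdom
    exact slope_ne_bot hpos (le_bot_iff.1 hdom)
  lift R to ℝ using ⟨htop, hbot⟩ with m
  exact ⟨m, hle, d, hd, by rwa [EReal.coe_sub]⟩

theorem Dominant.exists_dominantRates (hf : NearParabolic f) (hdom : Dominant p f (k + 1)) :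
    ∃ σ σ', DominantRates p f k σ σ' := by
  obtain ⟨m, hM, d, hd, hslope⟩ := hdom.exists_slope_le hf
  have hQ := hf.norm_one_sub_lam_pos
  have hp : (0 : ℝ) < p := Nat.cast_pos.2 (Fact.out : p.Prime).pos
  have hpos : 0 < p ^ (k + 1) * d := by
    have := (Finset.mem_Icc.1 hd).1
    have := (Fact.out : p.Prime).pos
    positivity
  refine ⟨‖1 - a f 0‖ ^ m, DominantRates.of_exists (Real.rpow_pos_of_pos hQ m) ?_ ⟨d, hd, ?_⟩⟩
  · intro l hl r s hr hs h
    rw [one_mul]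
    exact hf.norm_psi_le_of_le_slope h ((hM l hl).trans (sInf_le ⟨r, s, hr, hs, h, rfl⟩))
  · have hδ : ‖delta p f 0‖ = (‖1 - a f 0‖ ^ ((p : ℝ) ^ ((tau p f : ℤ) - 1))) ^ p := by
      rw [delta_eq, norm_pow, zero_add, ← Real.rpow_natCast, ← Real.rpow_mul_natCast hQ.le,
        ← zpow_add_one₀ hp.ne', sub_add_cancel, zpow_natCast, Nat.cast_pow]
    have hm : ‖1 - a f 0‖ ^ m = ‖1 - a f 0‖ ^ ((p : ℝ) ^ ((tau p f : ℤ) - 1)) *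
        ‖1 - a f 0‖ ^ (m - (p : ℝ) ^ ((tau p f : ℤ) - 1)) := by
      rw [← Real.rpow_add hQ, add_sub_cancel]
    rw [hm, hδ, mul_pow, ← pow_mul, ← mul_assoc, ← pow_succ']
    gcongr
    exact hf.le_norm_psi_of_slope_le hpos hslope

end Slope

section Propagation

open PowerSeries

variable {K : Type*} [NormedField K]

theorem exists_weierstrassDegree {σ : ℝ} {g : K⟦X⟧} {d N : ℕ} (hg : GaussBound σ 1 g)
    (hd : ‖coeff d g‖ = σ ^ d) (hN : ∀ n, N ≤ n → ‖coeff n g‖ < σ ^ n) :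
    ∃ e, d ≤ e ∧ e < N ∧ WeierstrassDegree σ e g := by
  classical
  have hdN : d < N := by
    by_contra! h
    exact (hN d h).ne hd
  set e := Nat.findGreatest (fun n => ‖coeff n g‖ = σ ^ n) N
  have he : ‖coeff e g‖ = σ ^ e :=
    Nat.findGreatest_spec (P := fun n => ‖coeff n g‖ = σ ^ n) hdN.le hd
  have heN : e < N := by
    by_contra! h
    exact (hN e h).ne he
  refine ⟨e, Nat.le_findGreatest hdN.le hd, heN, hg, he, fun n hn => ?_⟩
  rcases le_or_gt N n with hNn | hnN
  · exact hN n hNn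
  · exact (by simpa using hg n : ‖coeff n g‖ ≤ σ ^ n).lt_of_ne
      (Nat.findGreatest_is_greatest hn hnN.le)

theorem WeierstrassDegree.C_mul {σ : ℝ} {g : K⟦X⟧} {d : ℕ} {c : K} (hc : ‖c‖ = 1)
    (hg : WeierstrassDegree σ d g) : WeierstrassDegree σ d (C c * g) where
  bound n := by simpa [hc] using hg.bound n
  norm_coeff := by rw [coeff_C_mul, norm_mul, hc, one_mul, hg.norm_coeff]
  norm_coeff_lt n hn := by
    rw [coeff_C_mul, norm_mul, hc, one_mul]
    exact hg.norm_coeff_lt n hn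

theorem SmallBelow.C_mul {σ : ℝ} {g : K⟦X⟧} {N : ℕ} {c : K} (hc : ‖c‖ = 1)
    (hg : SmallBelow σ N g) : SmallBelow σ N (C c * g) := by
  intro n hn
  rw [coeff_C_mul, norm_mul, hc, one_mul]
  exact hg n hn

theorem sum_Ioo_filter_dvd {M : Type*} [AddCommMonoid M] (g : ℕ → M) (P : ℕ → Prop)
    [DecidablePred P] {c : ℕ} (hc : 0 < c) (n : ℕ) :
    ∑ x ∈ Finset.Ioo 0 (c * n) with c ∣ x ∧ P x, g x =
      ∑ i ∈ Finset.Ioo 0 n with P (c * i), g (c * i) := by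
  symm
  refine Finset.sum_nbij (c * ·) (fun i hi => ?_) (fun i _ j _ => Nat.eq_of_mul_eq_mul_left hc)
    (fun x hx => ?_) fun _ _ => rfl
  · simp only [Finset.mem_filter, Finset.mem_Ioo] at hi ⊢
    exact ⟨⟨mul_pos hc hi.1.1, Nat.mul_lt_mul_of_pos_left hi.1.2 hc⟩, dvd_mul_right c i, hi.2⟩
  · simp only [Finset.coe_filter, Finset.mem_Ioo, Set.mem_ofPred_eq] at hx
    obtain ⟨⟨h0, hlt⟩, ⟨i, rfl⟩, hP⟩ := hx
    exact ⟨i, Finset.mem_coe.2 (Finset.mem_filter.2 ⟨Finset.mem_Ioo.2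
      ⟨Nat.pos_of_mul_pos_left h0, lt_of_mul_lt_mul_left hlt hc.le⟩, hP⟩), rfl⟩

/-- The generating series of `χ_l(0, p ^ l * n)`. -/
noncomputable def chiSeries (p : ℕ) (f : K⟦X⟧) (l : ℕ) : K⟦X⟧ :=
  mk fun n => chi p f l 0 (p ^ l * n)

/-- The generating series of the weights with which `ψ_l(p ^ l * n, s)` enters in the recursion
for `χ_l(0, s)`. -/
noncomputable def vertexSeries (p : ℕ) (f : K⟦X⟧) (l : ℕ) : K⟦X⟧ :=
  mk fun n => if n = 0 then 1 else if p ∣ n then 0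
    else chi p f l 0 (p ^ l * n) * kappa p f l (p ^ l * n)

/-- The generating series of the `ψ_l(0, p ^ l * d)` with `1 ≤ d < p`, the values that enter in
the definition of dominance. -/
noncomputable def stepSeries (p : ℕ) (f : K⟦X⟧) (l : ℕ) : K⟦X⟧ :=
  mk fun d => if d ∈ Finset.Icc 1 (p - 1) then psi p f l 0 (p ^ l * d) else 0

theorem phi_self (p : ℕ) (f : K⟦X⟧) (l r : ℕ) : phi p f l r r = 0 := by
  rw [phi, Nat.sub_self, Finset.Icc_eq_empty (by lia), Finset.sum_empty]

theorem psi_self (p : ℕ) (f : K⟦X⟧) (l r : ℕ) : psi p f l r r = 0 := by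
  rw [psi, phi_self, zero_mul]

theorem coeff_vertexSeries_of_dvd {p : ℕ} (f : K⟦X⟧) (l : ℕ) {n : ℕ} (hn : n ≠ 0) (hpn : p ∣ n) :
    coeff n (vertexSeries p f l) = 0 := by
  rw [vertexSeries, coeff_mk, if_neg hn, if_pos hpn]

theorem coeff_vertexSeries_of_not_dvd {p : ℕ} (f : K⟦X⟧) (l : ℕ) {n : ℕ} (hpn : ¬ p ∣ n) :
    coeff n (vertexSeries p f l) = chi p f l 0 (p ^ l * n) * kappa p f l (p ^ l * n) := by
  have hn : n ≠ 0 := by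
    rintro rfl
    exact hpn (dvd_zero p)
  rw [vertexSeries, coeff_mk, if_neg hn, if_neg hpn]

variable {p : ℕ} [Fact p.Prime] {f : K⟦X⟧} {k : ℕ} {σ σ' : ℝ}

theorem DominantRates.exists_weierstrassDegree_stepSeries (h : DominantRates p f k σ σ') :
    ∃ e, 0 < e ∧ e < p ∧
      WeierstrassDegree (σ' ^ p ^ (k + 1)) e (stepSeries p f (k + 1)) := by
  have hσ := h.pos'
  obtain ⟨d, hd, hatt⟩ := h.attained
  have hbound : GaussBound (σ' ^ p ^ (k + 1)) 1 (stepSeries p f (k + 1)) := by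
    intro n
    rw [one_mul, stepSeries, coeff_mk, ← pow_mul]
    split_ifs with hn
    · exact h.le n hn
    · rw [norm_zero]
      positivity
  obtain ⟨e, hde, hep, he⟩ := exists_weierstrassDegree (d := d) (N := p) hbound
    (by rw [stepSeries, coeff_mk, if_pos hd, hatt, pow_mul]) (fun n hn => by
      have hn' : n ∉ Finset.Icc 1 (p - 1) := by
        have := (Fact.out : p.Prime).pos
        rw [Finset.mem_Icc]
        lia
      rw [stepSeries, coeff_mk, if_neg hn', norm_zero]
      positivity)
  exact ⟨e, (Finset.mem_Icc.1 hd).1.trans hde, hep, he⟩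

variable [CharP K p] [IsUltrametricDist K]

theorem NearParabolic.coeff_chiSeries (hf : NearParabolic f) (l n : ℕ) :
    coeff n (chiSeries p f l) =
      ∑ x ∈ Finset.HasAntidiagonal.antidiagonal n,
        coeff x.1 (vertexSeries p f l) * psi p f l (p ^ l * x.1) (p ^ l * (x.1 + x.2)) := by
  have hP : 0 < p ^ l := pow_pos (Fact.out : p.Prime).pos l
  rw [Finset.Nat.sum_antidiagonal_eq_sum_range_succ_mk, Finset.sum_range_succ]
  simp only [Nat.sub_self, add_zero, psi_self, mul_zero]
  rcases Nat.eq_zero_or_pos n with rfl | hn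
  · simp [chiSeries, chi, phi_self]
  rw [chiSeries, coeff_mk, hf.chi_eq_psi_add_sum l (mul_pos hP hn), sum_Ioo_filter_dvd _ _ hP,
    Finset.range_eq_Ico, ← Finset.Ioo_insert_left hn, Finset.sum_insert (by simp),
    Finset.sum_filter]
  congr 1
  · simp [vertexSeries]
  · refine Finset.sum_congr rfl fun i hi => ?_
    obtain ⟨hi0, hin⟩ := Finset.mem_Ioo.1 hi
    have hdvd : p ^ (l + 1) ∣ p ^ l * i ↔ p ∣ i := by rw [pow_succ, Nat.mul_dvd_mul_iff_left hP]
    rw [Nat.add_sub_cancel' hin.le]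
    by_cases hpi : p ∣ i
    · rw [if_neg (not_not.2 (hdvd.2 hpi)), coeff_vertexSeries_of_dvd f l hi0.ne' hpi, zero_mul]
    · rw [if_pos (mt hdvd.1 hpi), coeff_vertexSeries_of_not_dvd f l hpi]

theorem DominantRates.gaussBound_chiSeries (h : DominantRates p f k σ σ')
    (hf : NearParabolic f) : GaussBound (σ' ^ p ^ (k + 1)) 1 (chiSeries p f (k + 1)) := by
  intro n
  rcases Nat.eq_zero_or_pos n with rfl | hn
  · simp [chiSeries, chi, phi_self]
  rw [chiSeries, coeff_mk, ← pow_mul]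
  simpa using! hf.chi_kernelBound h.pos'.le (h.kernelBound hf) (dvd_zero _) (dvd_mul_right _ n)
    (mul_pos (pow_pos (Fact.out : p.Prime).pos _) hn)

theorem NearParabolic.norm_kappa_mul (hf : NearParabolic f) (l : ℕ) {n : ℕ} (hn : ¬ p ∣ n) :
    ‖kappa p f l (p ^ l * n)‖ = 1 := by
  refine hf.norm_kappa (dvd_mul_right _ _) ?_
  rwa [pow_succ, Nat.mul_dvd_mul_iff_left (pow_pos (Fact.out : p.Prime).pos _)]

theorem DominantRates.gaussBound_vertexSeries (h : DominantRates p f k σ σ')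
    (hf : NearParabolic f) : GaussBound (σ' ^ p ^ (k + 1)) 1 (vertexSeries p f (k + 1)) := by
  intro n
  have hσ := h.pos'
  rcases Nat.eq_zero_or_pos n with rfl | hn
  · simp [vertexSeries]
  by_cases hpn : p ∣ n
  · rw [coeff_vertexSeries_of_dvd f _ hn.ne' hpn, norm_zero]
    positivity
  · rw [coeff_vertexSeries_of_not_dvd f _ hpn, norm_mul, hf.norm_kappa_mul _ hpn, mul_one]
    simpa [chiSeries] using h.gaussBound_chiSeries hf n

theorem DominantRates.norm_psi_sub_coeff_stepSeries_lt (h : DominantRates p f k σ σ')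
    (hf : NearParabolic f) (i d : ℕ) :
    ‖psi p f (k + 1) (p ^ (k + 1) * i) (p ^ (k + 1) * (i + d)) -
      coeff d (stepSeries p f (k + 1))‖ < (σ' ^ p ^ (k + 1)) ^ d := by
  have hP : 0 < p ^ (k + 1) := pow_pos (Fact.out : p.Prime).pos _
  rcases Nat.eq_zero_or_pos d with rfl | hd
  · simp [stepSeries, psi_self]
  rw [stepSeries, coeff_mk, ← pow_mul]
  split_ifs with hdp
  · rw [mul_add, add_comm (p ^ (k + 1) * i)]
    simpa using h.norm_psi_shift_sub_lt hf (dvd_zero _) (dvd_mul_right _ d)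
      (dvd_mul_right (p ^ (k + 1)) i) (mul_pos hP hd)
  · rw [Finset.mem_Icc] at hdp
    have hpd : p ^ (k + 2) ≤ p ^ (k + 1) * d := by
      rw [pow_succ _ (k + 1)]
      gcongr
      lia
    simpa [mul_add] using h.norm_psi_lt hf (dvd_mul_right _ i) (dvd_mul_right _ (i + d))
      (by rw [mul_add]; gcongr)

theorem DominantRates.smallBelow_chiSeries_sub (h : DominantRates p f k σ σ')
    (hf : NearParabolic f) (N : ℕ) :
    SmallBelow (σ' ^ p ^ (k + 1)) N
      (chiSeries p f (k + 1) - stepSeries p f (k + 1) * vertexSeries p f (k + 1)) := by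
  intro n _
  have hσ := h.pos'
  rw [map_sub, hf.coeff_chiSeries, mul_comm (stepSeries p f (k + 1)), coeff_mul,
    ← Finset.sum_sub_distrib]
  refine norm_sum_lt (by positivity) fun x hx => ?_
  rw [← mul_sub, norm_mul, ← Finset.HasAntidiagonal.mem_antidiagonal.1 hx, pow_add _ x.1 x.2]
  refine mul_lt_mul' ?_ (h.norm_psi_sub_coeff_stepSeries_lt hf x.1 x.2) (norm_nonneg _)
    (by positivity)
  simpa using h.gaussBound_vertexSeries hf x.1

theorem DominantRates.smallBelow_euler_sub_chiSeries (h : DominantRates p f k σ σ')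
    (hf : NearParabolic f) {v : ℕ} (hv : u f = p ^ tau p f * v)
    (hχ : ∀ d ∈ Finset.Icc 1 (p - 1),
      ‖chi p f (k + 1) 0 (p ^ (k + 2) * d)‖ < σ' ^ (p ^ (k + 2) * d)) :
    SmallBelow (σ' ^ p ^ (k + 1)) (p ^ 2)
      (C (v : K) * euler K (vertexSeries p f (k + 1)) - chiSeries p f (k + 1)) := by
  intro n hn
  have hσ := h.pos'
  rw [map_sub, coeff_C_mul, coeff_euler]
  rcases Nat.eq_zero_or_pos n with rfl | hn0
  · simp [chiSeries, chi, phi_self]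
  by_cases hpn : p ∣ n
  · obtain ⟨d, rfl⟩ := hpn
    have hd : d < p := by
      rw [pow_two] at hn
      exact lt_of_mul_lt_mul_left hn (Nat.zero_le p)
    rw [coeff_vertexSeries_of_dvd f _ hn0.ne' (dvd_mul_right p d), mul_zero, mul_zero, zero_sub,
      norm_neg, chiSeries, coeff_mk, ← pow_mul, ← mul_assoc, ← pow_succ]
    exact hχ d (Finset.mem_Icc.2 ⟨Nat.pos_of_mul_pos_left hn0, by lia⟩)
  · have hsplit : (v : K) * (n * coeff n (vertexSeries p f (k + 1))) -
        coeff n (chiSeries p f (k + 1)) = coeff n (chiSeries p f (k + 1)) *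
          (((v * n : ℕ) : K) * kappa p f (k + 1) (p ^ (k + 1) * n) - 1) := by
      rw [coeff_vertexSeries_of_not_dvd f _ hpn, chiSeries, coeff_mk]
      push_cast
      ring
    rw [hsplit, norm_mul, ← mul_one (_ ^ n)]
    exact mul_lt_mul' (by simpa using h.gaussBound_chiSeries hf n)
      (hf.norm_mul_kappa_sub_one_lt hv (k + 1) hpn) (norm_nonneg _) (by positivity)

/-- If all these `χ` were small, then the vertex series `Y` and the step series `W` would satisfy
`v * euler Y ≈ W * Y` below degree `p ^ 2`, where `u = p ^ τ * v`. -/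
theorem DominantRates.exists_le_norm_chi (h : DominantRates p f k σ σ') (hf : NearParabolic f) :
    ∃ d ∈ Finset.Icc 1 (p - 1),
      σ' ^ (p ^ (k + 2) * d) ≤ ‖chi p f (k + 1) 0 (p ^ (k + 2) * d)‖ := by
  by_contra! hχ
  obtain ⟨v, hv, hpv⟩ := hf.exists_u_eq p
  obtain ⟨e, he, hep, hW⟩ := h.exists_weierstrassDegree_stepSeries
  have hv1 : ‖(v : K)⁻¹‖ = 1 := by rw [norm_inv, norm_natCast_eq_one p hpv, inv_one]
  have hv0 : (v : K) ≠ 0 := by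
    intro h0
    simp [h0] at hv1
  refine (hW.C_mul hv1).not_smallBelow_euler_sub p (pow_pos h.pos' _) he hep
    (Y := vertexSeries p f (k + 1)) ?_ (h.gaussBound_vertexSeries hf) ?_
  · simp [vertexSeries, ← coeff_zero_eq_constantCoeff_apply]
  · have hsmall := ((h.smallBelow_euler_sub_chiSeries hf hv hχ).add
      (h.smallBelow_chiSeries_sub hf (p ^ 2))).C_mul hv1
    rwa [sub_add_sub_cancel, mul_sub, ← mul_assoc, ← mul_assoc, ← map_mul, inv_mul_cancel₀ hv0,
      map_one, one_mul] at hsmall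

end Propagation

section Growth

open PowerSeries

variable {K : Type*} [NormedField K] [IsUltrametricDist K] {p : ℕ} [Fact p.Prime] [CharP K p]
  {f : K⟦X⟧} {k : ℕ} {σ σ' : ℝ}

theorem DominantRates.succ (h : DominantRates p f k σ σ') (hf : NearParabolic f) :
    ∃ σ'', DominantRates p f (k + 1) σ' σ'' := by
  refine DominantRates.of_exists h.pos' (fun l hl r s hr hs hrs => ?_) ?_
  · rcases Nat.lt_succ_iff_lt_or_eq.1 hl with hl | rfl
    · refine (h.bound l hl hr hs hrs).trans ?_
      rw [one_mul, one_mul]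
      exact pow_le_pow_left₀ h.pos.le (h.lt hf).le _
    · exact h.kernelBound hf hr hs hrs
  obtain ⟨d, hd, hχ⟩ := h.exists_le_norm_chi hf
  refine ⟨d, hd, hχ.trans ?_⟩
  have hdp : d + 1 ≤ p := by
    have := (Fact.out : p.Prime).pos
    rw [Finset.mem_Icc] at hd
    lia
  have hs : 0 < p ^ (k + 2) * d :=
    mul_pos (pow_pos (Fact.out : p.Prime).pos _) (Finset.mem_Icc.1 hd).1
  have hδ := hf.norm_delta_pos p (k + 1)
  rw [pow_mul, ← norm_pow, ← delta_eq_pow]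
  refine le_of_mul_le_mul_right ?_ hδ
  calc ‖chi p f (k + 1) 0 (p ^ (k + 2) * d)‖ * ‖delta p f (k + 1)‖
      = ‖psi p f (k + 2) 0 (p ^ (k + 2) * d)‖ * ‖delta p f (k + 1)‖ ^ p := by
        rw [← hf.norm_psi_succ_mul (k + 1) 0 hs, delta_succ p f (k + 1), norm_pow]
    _ ≤ ‖psi p f (k + 2) 0 (p ^ (k + 2) * d)‖ * ‖delta p f (k + 1)‖ ^ (d + 1) :=
        mul_le_mul_of_nonneg_left
          (pow_le_pow_of_le_one hδ.le (hf.norm_delta_lt_one p (k + 1)).le hdp) (norm_nonneg _)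
    _ = ‖delta p f (k + 1)‖ ^ d * ‖psi p f (k + 2) 0 (p ^ (k + 2) * d)‖ *
          ‖delta p f (k + 1)‖ := by ring

theorem DominantRates.iterate (h : DominantRates p f k σ σ') (hf : NearParabolic f) (j : ℕ) :
    ∃ ρ ρ', DominantRates p f (k + j) ρ ρ' ∧ σ' ^ p ≤ ‖delta p f 0‖ ^ j * ρ' ^ p := by
  induction j with
  | zero => exact ⟨σ, σ', h, by rw [pow_zero, one_mul]⟩
  | succ j ih =>
    obtain ⟨ρ, ρ', hρ, hle⟩ := ih
    obtain ⟨ρ'', hρ''⟩ := hρ.succ hf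
    refine ⟨ρ', ρ'', hρ'', hle.trans ?_⟩
    rw [pow_succ, mul_assoc]
    gcongr
    exact hρ''.gap

theorem DominantRates.exists_lt (h : DominantRates p f k σ σ') (hf : NearParabolic f) {T : ℝ}
    (hT : 0 < T) : ∃ l ρ ρ', DominantRates p f l ρ ρ' ∧ T < ρ' := by
  obtain ⟨j, hj⟩ := exists_pow_lt_of_lt_one (div_pos (pow_pos h.pos' p) (pow_pos hT p))
    (hf.norm_delta_lt_one p 0)
  rw [lt_div_iff₀ (pow_pos hT p)] at hj
  obtain ⟨ρ, ρ', hρ, hle⟩ := h.iterate hf j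
  refine ⟨k + j, ρ, ρ', hρ, lt_of_pow_lt_pow_left₀ p hρ.pos'.le ?_⟩
  exact lt_of_mul_lt_mul_left (hj.trans_le hle) (by positivity)

end Growth

section Linearization

open PowerSeries

variable {K : Type*} [NormedField K]

theorem Phi_eq_zero {f : K⟦X⟧} {r s : ℕ} (h : ¬ u f ∣ s - r) : Phi f r s = 0 := by
  rw [Phi, Finset.sum_eq_zero, mul_zero]
  intro α hα
  simp only [I, Finset.mem_filter] at hα
  obtain ⟨-, hsum, hzero⟩ := hα
  refine absurd (hsum ▸ Finset.dvd_sum fun i _ => ?_) h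
  by_cases hi : u f ∣ (i : ℕ)
  · exact hi.mul_right _
  · rw [hzero i hi, mul_zero]
    exact dvd_zero _

theorem subst_eq_C_mul_of_linearization {R : Type*} [CommRing R] {f g h : R⟦X⟧} {c : R}
    (hf0 : constantCoeff f = 0) (hg0 : constantCoeff g = 0) (hh0 : constantCoeff h = 0)
    (hgh : subst h g = (X : R⟦X⟧)) (hlin : subst (subst g f : R⟦X⟧) h = C c * (X : R⟦X⟧)) :
    subst f h = C c * h := by
  have hh : HasSubst h := HasSubst.of_constantCoeff_zero' hh0
  have hg : HasSubst g := HasSubst.of_constantCoeff_zero' hg0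
  have hgf : HasSubst (subst g f : R⟦X⟧) :=
    HasSubst.of_constantCoeff_zero' (constantCoeff_subst_eq_zero hg0 f hf0)
  have hcomp := congrArg (subst h) hlin
  rw [subst_comp_subst_apply hgf hh, subst_comp_subst_apply hg hh, hgh, X_subst, subst_mul hh,
    subst_X hh, subst_C] at hcomp
  exact hcomp

theorem coeff_subst_eq_sum {R : Type*} [CommRing R] {f : R⟦X⟧} (hf0 : constantCoeff f = 0)
    (h : R⟦X⟧) (n : ℕ) :
    coeff n (subst f h : R⟦X⟧) = ∑ d ∈ Finset.range (n + 1), coeff d h * coeff n (f ^ d) := by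
  rw [coeff_subst' (HasSubst.of_constantCoeff_zero' hf0),
    finsum_eq_sum_of_support_subset (s := Finset.range (n + 1))]
  · simp only [smul_eq_mul]
  · refine Function.support_subset_iff'.2 fun d hd => ?_
    rw [Finset.mem_coe, Finset.mem_range, not_lt] at hd
    refine mul_eq_zero_of_right _ (coeff_of_lt_order _ ?_)
    exact (Nat.cast_lt.2 (Nat.lt_of_succ_le hd)).trans_le
      (le_order_pow_of_constantCoeff_eq_zero d hf0)

theorem coeff_one_ne_zero_of_subst_eq_X {R : Type*} [CommRing R] [Nontrivial R] {g h : R⟦X⟧}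
    (hg0 : constantCoeff g = 0) (hhg : subst g h = (X : R⟦X⟧)) : coeff 1 h ≠ 0 := by
  intro h1
  have hcoeff := congrArg (coeff 1) hhg
  rw [coeff_subst_eq_sum hg0, Finset.sum_range_succ, Finset.sum_range_one, h1, pow_zero,
    coeff_one, if_neg one_ne_zero, mul_zero, zero_mul, add_zero, coeff_one_X] at hcoeff
  exact zero_ne_one hcoeff

variable {f h : K⟦X⟧}

theorem coeff_succ_pow_succ (hf0 : constantCoeff f = 0) {r n : ℕ} (hr : r ≤ n) :
    coeff (n + 1) (f ^ (r + 1)) = coeff (n - r) (mk (a f) ^ (r + 1)) := by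
  have hX : f = X * mk (a f) := by
    ext (_ | n)
    · simpa using hf0
    · rw [coeff_succ_X_mul, coeff_mk, a]
  conv_lhs => rw [hX]
  rw [mul_pow, show n + 1 = (n - r) + (r + 1) by lia, coeff_X_pow_mul]

theorem coeff_succ_eq_sum_Phi (hfne : ∃ i, 1 ≤ i ∧ a f i ≠ 0) (hf0 : constantCoeff f = 0)
    (hh0 : constantCoeff h = 0) (hfh : subst f h = C (a f 0) * h) {n : ℕ}
    (hn : a f 0 * (1 - a f 0 ^ n) ≠ 0) :
    coeff (n + 1) h = ∑ r ∈ Finset.range n, coeff (r + 1) h * Phi f r n := by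
  have hcoeff := congrArg (coeff (n + 1)) hfh
  rw [coeff_subst_eq_sum hf0, coeff_C_mul, Finset.sum_range_succ',
    coeff_zero_eq_constantCoeff_apply, hh0, zero_mul, add_zero, Finset.sum_range_succ,
    coeff_succ_pow_succ hf0 le_rfl, Nat.sub_self, coeff_zero_eq_constantCoeff_apply, map_pow,
    ← coeff_zero_eq_constantCoeff_apply, coeff_mk] at hcoeff
  refine mul_left_cancel₀ hn ?_
  calc a f 0 * (1 - a f 0 ^ n) * coeff (n + 1) h
      = ∑ r ∈ Finset.range n, coeff (r + 1) h * coeff (n + 1) (f ^ (r + 1)) := by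
        linear_combination -hcoeff
    _ = a f 0 * (1 - a f 0 ^ n) * ∑ r ∈ Finset.range n, coeff (r + 1) h * Phi f r n := by
        rw [Finset.mul_sum]
        refine Finset.sum_congr rfl fun r hr => ?_
        rw [Phi_eq hfne, coeff_succ_pow_succ hf0 (Finset.mem_range.1 hr).le,
          mul_left_comm, one_div, mul_inv_cancel_left₀ hn]

theorem sum_range_mul_Phi (g : ℕ → K) (hu : 0 < u f) (s : ℕ) :
    ∑ r ∈ Finset.range (u f * s), g r * Phi f r (u f * s) =
      ∑ r ∈ Finset.range s, g (u f * r) * Phi f (u f * r) (u f * s) := by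
  symm
  refine Finset.sum_of_injOn (u f * ·) (fun x _ y _ => Nat.eq_of_mul_eq_mul_left hu) ?_ ?_
    fun _ _ => rfl
  · intro r hr
    simpa [hu] using hr
  · intro r hr hr'
    rw [Phi_eq_zero, mul_zero]
    intro hdvd
    rw [Finset.mem_range] at hr
    obtain ⟨i, rfl⟩ := (Nat.dvd_sub_iff_right hr.le (dvd_mul_right _ _)).1 hdvd
    exact hr' ⟨i, Finset.mem_coe.2 (Finset.mem_range.2 (lt_of_mul_lt_mul_left hr (Nat.zero_le _))),
      rfl⟩

theorem LocallyAnalytic.exists_norm_coeff_div_le (hh : LocallyAnalytic h) (c : K) (v : ℕ) :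
    ∃ T : ℝ, 0 < T ∧ ∀ s, 0 < s → ‖coeff (v * s + 1) h / c‖ ≤ T ^ s := by
  obtain ⟨ρ, hρ, hr⟩ := hh
  rw [isRestricted_iff'] at hr
  obtain ⟨B, hB⟩ := hr.bddAbove_range
  set A := B * ρ⁻¹ / ‖c‖ with hA
  refine ⟨max 1 A * (ρ ^ v)⁻¹, by positivity, fun s hs => ?_⟩
  rw [norm_div]
  calc ‖coeff (v * s + 1) h‖ / ‖c‖ ≤ B / ρ ^ (v * s + 1) / ‖c‖ := by
        gcongr
        rw [le_div_iff₀ (pow_pos hρ _)]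
        exact hB ⟨v * s + 1, rfl⟩
    _ = A * ((ρ ^ v)⁻¹) ^ s := by
        rw [hA, pow_succ, pow_mul, inv_pow]
        field_simp
    _ ≤ max 1 A ^ s * ((ρ ^ v)⁻¹) ^ s := by
        gcongr
        exact (le_max_right 1 A).trans (le_self_pow₀ (le_max_left 1 A) hs.ne')
    _ = (max 1 A * (ρ ^ v)⁻¹) ^ s := (mul_pow _ _ _).symm

variable [IsUltrametricDist K]

theorem NearParabolic.coeff_div_coeff_one_eq (hf : NearParabolic f) (p : ℕ) [Fact p.Prime]
    [CharP K p] (hf0 : constantCoeff f = 0) (hh0 : constantCoeff h = 0) (hh1 : coeff 1 h ≠ 0)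
    (hfh : subst f h = C (a f 0) * h) {s : ℕ} (hs : 0 < s) :
    coeff (u f * s + 1) h / coeff 1 h = Phi f (u f * 0) (u f * s) +
      ∑ x ∈ Finset.Ioo 0 s, coeff (u f * x + 1) h / coeff 1 h * Phi f (u f * x) (u f * s) := by
  have hn : a f 0 * (1 - a f 0 ^ (u f * s)) ≠ 0 :=
    mul_ne_zero hf.lam_ne_zero (hf.one_sub_ne_zero p (mul_pos hf.u_pos hs))
  rw [coeff_succ_eq_sum_Phi hf.exists_ne hf0 hh0 hfh hn,
    sum_range_mul_Phi (fun r => coeff (r + 1) h) hf.u_pos, Finset.range_eq_Ico,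
    ← Finset.Ioo_insert_left hs, Finset.sum_insert Finset.left_notMem_Ioo, add_div,
    Finset.sum_div, mul_zero, zero_add, mul_div_cancel_left₀ _ hh1]
  simp only [mul_div_right_comm]

theorem DominantRates.exists_pow_le_norm {p : ℕ} [Fact p.Prime] [CharP K p] {k : ℕ}
    {σ σ' : ℝ} (h : DominantRates p f k σ σ')
    (hf : NearParabolic f) {B : ℕ → K}
    (hB : ∀ s, 0 < s → B s = Phi f (u f * 0) (u f * s) +
      ∑ x ∈ Finset.Ioo 0 s, B x * Phi f (u f * x) (u f * s)) :
    ∃ s, 0 < s ∧ σ' ^ s ≤ ‖B s‖ := by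
  by_contra! hlt
  have hσ := h.pos'
  obtain ⟨d, hd, hatt⟩ := h.attained
  rw [Finset.mem_Icc] at hd
  have hpd : ¬ p ∣ d := Nat.not_dvd_of_pos_of_lt hd.1 (by lia)
  set s := p ^ (k + 1) * d
  have hs : 0 < s := mul_pos (pow_pos (Fact.out : p.Prime).pos _) hd.1
  have hφ (r : ℕ) : ‖phi p f (k + 1) r s‖ = ‖psi p f (k + 1) r s‖ := by
    rw [← hf.psi_mul_kappa (k + 1) r hs, norm_mul, hf.norm_kappa_mul (k + 1) hpd, mul_one]
  have hrec := rec_refine (P := fun x => p ^ (k + 1) ∣ x) (P' := fun _ => False)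
    (fun _ => False.elim) (fun r s => phi_eq_Phi_add_sum p f (k + 1)) (by simpa using hB) hs
  have hφlt : ‖phi p f (k + 1) 0 s‖ < σ' ^ s := by
    rw [eq_sub_of_add_eq hrec.symm]
    refine norm_sub_lt (hlt s hs) (norm_sum_lt (by positivity) fun x hx => ?_)
    simp only [Finset.mem_filter, Finset.mem_Ioo] at hx
    obtain ⟨⟨hx0, hxs⟩, hxk, -⟩ := hx
    rw [norm_mul, hφ, ← pow_mul_pow_sub σ' hxs.le]
    refine mul_lt_mul_of_lt_of_le_of_nonneg_of_pos (hlt x hx0) ?_ (norm_nonneg _) (by positivity)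
    simpa using h.kernelBound hf hxk (dvd_mul_right _ d) hxs
  rw [hφ, hatt] at hφlt
  exact hφlt.false

end Linearization

end NonLin

theorem mainTheorem1_general {K : Type*} [NormedField K] [IsUltrametricDist K]
    (p : ℕ) [Fact p.Prime] [CharP K p] (lam : K) (hlam1 : lam ≠ 1) (hlam : ‖1 - lam‖ < 1)
    (f : PowerSeries K) (hf0 : PowerSeries.constantCoeff f = 0)
    (hf1 : PowerSeries.coeff 1 f = lam)
    (hfne : ∃ i : ℕ, 1 ≤ i ∧ PowerSeries.coeff (i + 1) f ≠ 0)
    (k : ℕ) (hk : 1 ≤ k) (hdom : NonLin.Dominant p f k) :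
    ¬ NonLin.Linearizable f := by
  obtain ⟨k, rfl⟩ := Nat.exists_eq_add_of_le' hk
  subst hf1
  have hf : NonLin.NearParabolic f := ⟨hfne, hlam1, hlam⟩
  rintro ⟨h, g, hh, hh0, hg0, hhg, hgh, hlin⟩
  have hfh := NonLin.subst_eq_C_mul_of_linearization hf0 hg0 hh0 hgh hlin
  have hh1 := NonLin.coeff_one_ne_zero_of_subst_eq_X hg0 hhg
  obtain ⟨T, hT, hle⟩ := hh.exists_norm_coeff_div_le (PowerSeries.coeff 1 h) (NonLin.u f)
  obtain ⟨σ, σ', hσ⟩ := hdom.exists_dominantRates hf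
  obtain ⟨l, ρ, ρ', hρ, hTρ⟩ := hσ.exists_lt hf hT
  obtain ⟨s, hs, hge⟩ := hρ.exists_pow_le_norm hf fun s hs =>
    hf.coeff_div_coeff_one_eq p hf0 hh0 hh1 hfh hs
  exact (hge.trans (hle s hs)).not_gt (pow_lt_pow_left₀ hTρ hT.le hs.ne')

theorem mainTheorem1 {K : Type*} [NormedField K] [IsUltrametricDist K] [CompleteSpace K]
    (p : ℕ) [Fact p.Prime] (hp : 3 ≤ p) [CharP K p]
    (lam : K) (hroot : ∀ n : ℕ, 1 ≤ n → lam ^ n ≠ 1) (hlam : ‖1 - lam‖ < 1)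
    (f : PowerSeries K) (hf0 : PowerSeries.constantCoeff f = 0)
    (hf1 : PowerSeries.coeff 1 f = lam) (hfan : NonLin.LocallyAnalytic f)
    (hfne : ∃ i : ℕ, 1 ≤ i ∧ PowerSeries.coeff (i + 1) f ≠ 0)
    (k : ℕ) (hk : 1 ≤ k) (hdom : NonLin.Dominant p f k) :
    ¬ NonLin.Linearizable f := by
  exact mainTheorem1_general p lam (by simpa using hroot 1 le_rfl) hlam f hf0 hf1 hfne k hk hdom
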